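/- Setting. Let $0<R<R'$, $\bar w>0$, let $d\ge 0$ be an integer and let $a(v_0,v_1)$, $a_0(v_0,v_1),\dots,a_d(v_0,v_1)$ be holomorphic on $D(0,R')^2$. For $m=1,2$ let $b_{m,k}(v_0,v_1,u_0,w)=\sum_{\alpha\ge0}b_{m,k,\alpha}(v_0,v_1,u_0)\,w^\alpha/\alpha!$ be holomorphic on $D(0,R')^2\times\mathbb C\times D(0,\bar w)$ and polynomial in $u_0$ of degree at most $d_{m,k}$. Let $\nu>0$, $b>1$, $\sigma>0$, $\bar\delta>0$, $0<\bar V_0,\bar V_1<R'-R$, and put $I(\alpha)=\{0,\dots,\alpha\}$, $\bar U_h=\bar\delta/(h^b+1)$, $r_b(\alpha)=\sum_{n=0}^{\alpha}(n+1)^{-b}$. Spaces. For $\rho>1$ and $\bar W>0$ let $G_{(\rho,\bar V_0,\bar V_1,(\bar U_h)_{h\ge0},\bar W)}$ be the space of formal series $$\Psi=\sum_{\alpha\ge0}\Psi_\alpha\frac{W^\alpha}{\alpha!},\qquad \Psi_\alpha=\sum_{n_0,n_1,l_h\ge 0,\,h\in I(\alpha)}\psi_{\alpha,n_0,n_1,(l_h)_{h\in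 I(\alpha)}}\frac{V_0^{n_0}}{n_0!}\frac{V_1^{n_1}}{n_1!}\prod_{h\in I(\alpha)}\frac{U_h^{l_h}}{l_h!}$$ with complex coefficients, for which $$\|\Psi\|_{(\rho,\bar V_0,\bar V_1,(\bar U_h),\bar W)}=\sum_{\alpha\ge0}\ \sum_{n_0,n_1,l_h}\frac{|\psi_{\alpha,n_0,n_1,(l_h)}|}{\exp(\sigma r_b(\alpha)\rho)}\frac{\bar V_0^{n_0}\bar V_1^{n_1}\prod_{h\in I(\alpha)}\bar U_h^{l_h}}{(n_0+n_1+\sum_{h\in I(\alpha)}l_h+\alpha)!}\,\bar W^\alpha$$ is finite. Operators. For a function $F(v_0,v_1,(u_h)_{h\in I(N)})$ let its majorant series be the formal series in $V_0,V_1,(U_h)_{h\in I(N)}$ whose coefficient of $\frac{V_0^{n_0}}{n_0!}\frac{V_1^{n_1}}{n_1!}\prod_h\frac{U_h^{l_h}}{l_h!}$ is the supremum of $|\partial_{v_0}^{n_0}\partial_{v_1}^{n_1}\prod_{h}\partial_{u_h}^{l_h}F|$ over $|v_0|<R$, $|v_1|<R$, $|u_h|<\rho$, $h\in I(N)$. Let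 $B_{m,k}(V_0,V_1,U_0,W)=\sum_\alpha B_{m,k,\alpha}W^\alpha/\alpha!$, where $B_{m,k,\alpha}$ is the majorant series of $b_{m,k,\alpha}$. For $0\le j\le\alpha$ let $\mathbf A_{j,\alpha+1}$ and $\mathbf B_{j,\alpha+1}$ be the majorant series, in $V_0,V_1,(U_h)_{h\in I(\alpha+1)}$, of $$A_j=\sum_{l_1+l_2=j}\frac{\partial_{v_1}^{l_1}a}{l_1!\,\nu^{l_1}}(l_2+1)\nu u_{l_2+1}+\sum_{p=0}^d\ \sum_{j_0+\dots+j_p=j}\frac{\partial_{v_1}^{j_0}a_p}{j_0!\,\nu^{j_0}}\prod_{l=1}^p u_{j_l},\qquad B_j=(j+1)\nu u_{j+1},$$ and let $$\mathbb D_{\mathbf A}\Psi=\sum_{\alpha\ge0}\Big(\sum_{j\in I(\alpha)}\mathbf A_{j,\alpha+1}\,\partial_{U_j}\Psi_\alpha\Big)\frac{W^\alpha}{\alpha!},\qquad \mathbb D_{\mathbf B}\Psi=\sum_{\alpha\ge0}\Big(\sum_{j\in I(\alpha)}\mathbf B_{j,\alpha+1}\,\partial_{U_j}\Psi_\alpha\Big)\frac{W^\alpha}{\alpha!}.$$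 Let $\partial_W^{-n}$ be the $n$-th iterate of the formal integration $\int_0^W$. Proposition 8. Let $S,k\ge0$ be integers and let $0<W_0<\bar w$. 1) Suppose that $\nu$ is so large that $\nu(R'-R-\bar V_1)>1$, and that $$S\ \ge\ k+1+\max\big(b(d_{1,k}+2)+3,\ d+1+b(d+d_{1,k}+1)\big).$$ Then there is a constant $C_{8.1}>0$, independent of $\rho>1$ and of $\bar W\in(0,W_0]$, such that for all $\rho>1$, all $\bar W\in(0,W_0]$ and all $\Psi\in G_{(\rho,\bar V_0,\bar V_1,(\bar U_h),\bar W)}$ the series $B_{1,k}\partial_W^{-S+k}\mathbb D_{\mathbf A}\Psi$ belongs to $G_{(\rho,\bar V_0,\bar V_1,(\bar U_h),\bar W)}$ and $$\|B_{1,k}\,\partial_W^{-S+k}\mathbb D_{\mathbf A}\Psi\|_{(\rho,\bar V_0,\bar V_1,(\bar U_h),\bar W)}\le C_{8.1}\,\bar W^{S-k}\,\|\Psi\|_{(\rho,\bar V_0,\bar V_1,(\bar U_h),\bar W)}.$$ 2) Suppose that $S\ge k+3+b(2+d_{2,k})$. Then there is a constant $C_{8.2}>0$, independent of $\rho>1$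 and of $\bar W\in(0,W_0]$, such that for all $\rho>1$, all $\bar W\in(0,W_0]$ and all $\Psi\in G_{(\rho,\bar V_0,\bar V_1,(\bar U_h),\bar W)}$ the series $B_{2,k}\partial_W^{-S+k}\mathbb D_{\mathbf B}\Psi$ belongs to $G_{(\rho,\bar V_0,\bar V_1,(\bar U_h),\bar W)}$ and $$\|B_{2,k}\,\partial_W^{-S+k}\mathbb D_{\mathbf B}\Psi\|_{(\rho,\bar V_0,\bar V_1,(\bar U_h),\bar W)}\le C_{8.2}\,\bar W^{S-k}\,\|\Psi\|_{(\rho,\bar V_0,\bar V_1,(\bar U_h),\bar W)}.$$ -/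

import Mathlib

open scoped Nat

noncomputable section

namespace MajorantSeries

/-- Index type of the variables other than `W` (or `w`): `Sum.inl 0`, `Sum.inl 1` stand for
`V₀`, `V₁` (or `v₀`, `v₁`), and `Sum.inr h` stands for `U_h` (or `u_h`), `h ≥ 0`. -/
abbrev Var : Type := Fin 2 ⊕ ℕ

/-- The index of the variable `V i`. -/
abbrev V (i : Fin 2) : Var := Sum.inl i

/-- The index of the variable `U h`. -/
abbrev U (h : ℕ) : Var := Sum.inr h

/-- Multi-indices `(n₀, n₁, (l_h)_h)`. -/
abbrev MultiIndex : Type := Var →₀ ℕ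

/-- The multi-index only involves `V₀`, `V₁` and `U_h` with `h ∈ I(N) = {0, …, N}`. -/
def Supported (N : ℕ) (m : MultiIndex) : Prop := ∀ h : ℕ, m (U h) ≠ 0 → h ≤ N

/-- `n₀! n₁! ∏ l_h!`. -/
def multiFactorial (m : MultiIndex) : ℕ := m.prod fun _ e => e !

/-- Formal series in the variables `V₀, V₁, (U_h)_{h ≥ 0}`. -/
abbrev VUSeries : Type := MvPowerSeries Var ℂ

/-- Formal series in `W` whose coefficients are formal series in `V₀, V₁, (U_h)_{h ≥ 0}`. -/
abbrev WSeries : Type := PowerSeries VUSeries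

/-- The coefficient `Ψ_α` in the expansion `Ψ = ∑ Ψ_α W^α / α!`. -/
def component (Ψ : WSeries) (α : ℕ) : VUSeries := (α ! : ℂ) • PowerSeries.coeff α Ψ

/-- The coefficient `ψ_m` in the expansion `Φ = ∑ ψ_m V₀^n₀/n₀! V₁^n₁/n₁! ∏ U_h^l_h/l_h!`. -/
def expCoeff (Φ : VUSeries) (m : MultiIndex) : ℂ :=
  (multiFactorial m : ℂ) * MvPowerSeries.coeff m Φ

/-! ### The spaces of formal series -/

/-- `r_b(α) = ∑_{n=0}^{α} 1/(n+1)^b`. -/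
def rSum (b : ℝ) (α : ℕ) : ℝ := ∑ n ∈ Finset.range (α + 1), 1 / ((n : ℝ) + 1) ^ b

/-- The numbers `V̄₀`, `V̄₁` and `Ū_h = δ̄ / (h^b + 1)`. -/
def radius (b Vbar₀ Vbar₁ δbar : ℝ) : Var → ℝ
  | Sum.inl i => if i = 0 then Vbar₀ else Vbar₁
  | Sum.inr h => δbar / ((h : ℝ) ^ b + 1)

/-- The general term of the series defining the norm of `E_{ρ,α,V̄₀,V̄₁,(Ū_h)}`. -/
def termE (b σ Vbar₀ Vbar₁ δbar ρ : ℝ) (α : ℕ) (Φ : VUSeries) (m : MultiIndex) : ℝ :=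
  ‖expCoeff Φ m‖ / Real.exp (σ * rSum b α * ρ) *
    ((m.prod fun i e => radius b Vbar₀ Vbar₁ δbar i ^ e) / ((m.degree + α)! : ℝ))

/-- The norm of `E_{ρ,α,V̄₀,V̄₁,(Ū_h)}`. -/
def normE (b σ Vbar₀ Vbar₁ δbar ρ : ℝ) (α : ℕ) (Φ : VUSeries) : ℝ :=
  ∑' m : MultiIndex, termE b σ Vbar₀ Vbar₁ δbar ρ α Φ m

/-- Membership in `E_{ρ,α,V̄₀,V̄₁,(Ū_h)}`: the series `Φ` lies in `ℂ[[V₀, V₁, (U_h)_{h ∈ I(α)}]]`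
and the series defining the norm converges. -/
structure MemE (b σ Vbar₀ Vbar₁ δbar ρ : ℝ) (α : ℕ) (Φ : VUSeries) : Prop where
  supported : ∀ m : MultiIndex, MvPowerSeries.coeff m Φ ≠ 0 → Supported α m
  summable : Summable (termE b σ Vbar₀ Vbar₁ δbar ρ α Φ)

/-- The norm of `G_{(ρ,V̄₀,V̄₁,(Ū_h),W̄)}`. -/
def normG (b σ Vbar₀ Vbar₁ δbar ρ Wbar : ℝ) (Ψ : WSeries) : ℝ :=
  ∑' α : ℕ, normE b σ Vbar₀ Vbar₁ δbar ρ α (component Ψ α) * Wbar ^ α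

/-- Membership in `G_{(ρ,V̄₀,V̄₁,(Ū_h),W̄)}`. -/
structure MemG (b σ Vbar₀ Vbar₁ δbar ρ Wbar : ℝ) (Ψ : WSeries) : Prop where
  memE : ∀ α : ℕ, MemE b σ Vbar₀ Vbar₁ δbar ρ α (component Ψ α)
  summable : Summable fun α : ℕ => normE b σ Vbar₀ Vbar₁ δbar ρ α (component Ψ α) * Wbar ^ α

/-! ### Suprema of derivatives and the associated formal series -/

/-- `∂_i^n F`, the iterated partial derivative of order `n` in the variable `i`. -/
def partialDeriv (i : Var) (n : ℕ) (F : (Var → ℂ) → ℂ) : (Var → ℂ) → ℂ :=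
  fun x => iteratedDeriv n (fun s : ℂ => F (Function.update x i s)) (x i)

/-- `∂_{v₀}^{n₀} ∂_{v₁}^{n₁} ∏_{h ∈ I(N)} ∂_{u_h}^{l_h} F`. -/
def mixedDeriv (N : ℕ) (m : MultiIndex) (F : (Var → ℂ) → ℂ) : (Var → ℂ) → ℂ :=
  partialDeriv (V 0) (m (V 0)) (partialDeriv (V 1) (m (V 1))
    ((List.range (N + 1)).foldr (fun h G => partialDeriv (U h) (m (U h)) G) F))

/-- The polydisc `|v₀| < R`, `|v₁| < R`, `|u_h| < ρ`. -/
def polydisc (R ρ : ℝ) : Set (Var → ℂ) :=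
  {x | (∀ i, ‖x (V i)‖ < R) ∧ ∀ h, ‖x (U h)‖ < ρ}

/-- The supremum over the polydisc of the modulus of the derivative of `F` of order `m`, for `F`
a function of `v₀`, `v₁` and `u_h`, `h ∈ I(N)`. -/
def supDeriv (R ρ : ℝ) (N : ℕ) (F : (Var → ℂ) → ℂ) (m : MultiIndex) : ℝ :=
  sSup ((fun x => ‖mixedDeriv N m F x‖) '' polydisc R ρ)

open scoped Classical in
/-- The formal series `∑ (sup |∂^m F|) V₀^n₀/n₀! V₁^n₁/n₁! ∏_{h ∈ I(N)} U_h^l_h/l_h!`. -/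
def majorant (R ρ : ℝ) (N : ℕ) (F : (Var → ℂ) → ℂ) : VUSeries :=
  fun m => if Supported N m then ((supDeriv R ρ N F m / (multiFactorial m : ℝ) : ℝ) : ℂ) else 0

/-- The coefficient `b_α(v₀, v₁, u₀)` in the expansion
`β(v₀, v₁, u₀, w) = ∑ b_α(v₀, v₁, u₀) w^α / α!`, as a function of `v₀, v₁, (u_h)`. -/
def wCoeff (β : ℂ × ℂ × ℂ × ℂ → ℂ) (α : ℕ) : (Var → ℂ) → ℂ :=
  fun x => iteratedDeriv α (fun w : ℂ => β (x (V 0), x (V 1), x (U 0), w)) 0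

/-- The formal series `B(V₀, V₁, U₀, W)` attached to `β(v₀, v₁, u₀, w)`. -/
def seriesB (R ρ : ℝ) (β : ℂ × ℂ × ℂ × ℂ → ℂ) : WSeries :=
  PowerSeries.mk fun α => ((α ! : ℂ)⁻¹) • majorant R ρ 0 (wCoeff β α)

/-- `∂_{v₁}^l f(v₀, v₁) / (l! ν^l)`. -/
def scaledDeriv (ν : ℝ) (f : ℂ × ℂ → ℂ) (l : ℕ) (v₀ v₁ : ℂ) : ℂ :=
  iteratedDeriv l (fun z : ℂ => f (v₀, z)) v₁ / ((l ! : ℂ) * (ν : ℂ) ^ l)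

/-- The function `A_j`, i.e. `∑_{l₁+l₂=j} ∂_{v₁}^{l₁}a/(l₁! ν^{l₁}) (l₂+1) ν u_{l₂+1}
+ ∑_{p=0}^d ∑_{j₀+⋯+j_p=j} ∂_{v₁}^{j₀}a_p/(j₀! ν^{j₀}) ∏_{l=1}^p u_{j_l}`. -/
def funA (ν : ℝ) (d : ℕ) (a : ℂ × ℂ → ℂ) (ap : ℕ → ℂ × ℂ → ℂ) (j : ℕ) : (Var → ℂ) → ℂ :=
  fun x =>
    ∑ l ∈ Finset.HasAntidiagonal.antidiagonal j,
        scaledDeriv ν a l.1 (x (V 0)) (x (V 1)) * (((l.2 : ℂ) + 1) * (ν : ℂ) * x (U (l.2 + 1)))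
      + ∑ p ∈ Finset.range (d + 1), ∑ c ∈ Finset.Nat.antidiagonalTuple (p + 1) j,
          scaledDeriv ν (ap p) (c 0) (x (V 0)) (x (V 1)) * ∏ l : Fin p, x (U (c l.succ))

/-- The function `B_j = (j+1) ν u_{j+1}`. -/
def funB (ν : ℝ) (j : ℕ) : (Var → ℂ) → ℂ :=
  fun x => ((j : ℂ) + 1) * (ν : ℂ) * x (U (j + 1))

/-! ### The operators -/

/-- For functions `F j` of `v₀, v₁, (u_h)_{h ∈ I(j+1)}`, with majorant series `𝐅_{j,α+1}` in
`V₀, V₁, (U_h)_{h ∈ I(α+1)}`, the operator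
`Ψ ↦ ∑_α (∑_{j ∈ I(α)} 𝐅_{j,α+1} ∂_{U_j} Ψ_α) W^α/α!`. -/
def opD (R ρ : ℝ) (F : ℕ → (Var → ℂ) → ℂ) (Ψ : WSeries) : WSeries :=
  PowerSeries.mk fun α => ((α ! : ℂ)⁻¹) •
    ∑ j ∈ Finset.range (α + 1),
      majorant R ρ (α + 1) (F j) * MvPowerSeries.pderiv ℂ (U j) (component Ψ α)

/-- The operator `𝔻_𝐀`. -/
def opDA (R ρ ν : ℝ) (d : ℕ) (a : ℂ × ℂ → ℂ) (ap : ℕ → ℂ × ℂ → ℂ) : WSeries → WSeries :=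
  opD R ρ (funA ν d a ap)

/-- The operator `𝔻_𝐁`. -/
def opDB (R ρ ν : ℝ) : WSeries → WSeries := opD R ρ (funB ν)

/-- Formal integration `∂_W^{-1} = ∫_0^W`. -/
def intW (Ψ : WSeries) : WSeries :=
  PowerSeries.mk fun n => if n = 0 then 0 else ((n : ℂ)⁻¹) • PowerSeries.coeff (n - 1) Ψ

/-! ### The coefficients of the equation -/

/-- `β(t, z, u₀, w)` is holomorphic on `D(0,R')² × ℂ × D(0,w̄)` and polynomial in `u₀`, of degree
at most `n`. -/
structure IsCoefficient (R' wbar : ℝ) (n : ℕ) (β : ℂ × ℂ × ℂ × ℂ → ℂ) : Prop where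
  holomorphic : DifferentiableOn ℂ β
    (Metric.ball 0 R' ×ˢ Metric.ball 0 R' ×ˢ Set.univ ×ˢ Metric.ball 0 wbar)
  polynomial : ∀ t ∈ Metric.ball (0 : ℂ) R', ∀ z ∈ Metric.ball (0 : ℂ) R',
    ∀ w ∈ Metric.ball (0 : ℂ) wbar,
      ∃ P : Polynomial ℂ, P.natDegree ≤ n ∧ ∀ u : ℂ, β (t, z, u, w) = P.eval u

end MajorantSeries

end

open scoped ENNReal
open Finset.HasAntidiagonal (antidiagonal mem_antidiagonal)

namespace MajorantSeries


/-! ### Weighted norms of formal series -/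

/-! The factorial in the norm grades the components. At level `t` a series `∑ c_m X^m` is measured
by `∑ |c_m| m! w^m / (|m| + t)!`, and `Ψ_α` sits at level `α`. A derivative `∂_{U_j}` raises the
level by one at the cost `1 / Ū_j` (`facNorm_pderiv_le`). Multiplication by a series of finite
weighted l¹ norm can raise the level from `t` to `t + u` with the gain `t! / (t + u)!`
(`facNorm_mul_le`).

Put `s = S - k`. The component of `B ∂_W^{-s} 𝔻Ψ` at `W^α` is the sum over `n + γ + s = α` of `α! /
(n! (γ + s)!) B_n (𝔻Ψ)_γ`. One of the `s` levels is used by the derivative; the others gain `(γ +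
1)! / (γ + s)! ≤ (γ + 2)^{-(s-1)}`. Multiplication by `B_n` climbs from `γ + s` to `α`, and its gain
cancels the binomial factor against Cauchy's bound `n! q^n` for `B_n`. What is left is a convolution
of a geometric series in `q W̄ < 1` with the norms of the `Ψ_γ` (`totalNorm_mul_intW_opD_le`).

The gain must absorb the sizes of the majorants. Each function involved is a finite sum of products
`g(v₀, v₁) ∏ u_h^{e_h}`, so the l¹ norm of its majorant factorises: Cauchy's estimates for `g` give
two geometric series, and the powers give `∏ (ρ + Ū_h)^{e_h}`, hence `ρ` to the total degree,
whatever the number of variables (`IsSumOfProducts.l1Norm_majorant_le`). Summing `‖𝐅_j‖ / Ū_j` over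
`j ≤ γ` costs a power of `γ + 2`. The powers of `ρ` are removed by the exponential weight: between
`γ` and `α ≥ γ + 1` the sum `r_b` grows by at least `(γ + 2)^{-b}`, and `ρ^n exp(-σρ(γ + 2)^{-b})`
is at most a constant times `(γ + 2)^{bn}` (`gain_le_const`). The hypothesis on `S` says exactly
that all these exponents add up to at most `s - 1`. -/

/-- `w^m = ∏ w_i^{m_i}`. -/
noncomputable def monomialWeight (w : Var → ℝ) (m : MultiIndex) : ℝ := m.prod fun i e => w i ^ e

/-- `∑ |c_m| w^m` for `Φ = ∑ c_m X^m`. -/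
noncomputable def l1Norm (w : Var → ℝ) (Φ : VUSeries) : ℝ≥0∞ :=
  ∑' m : MultiIndex, ENNReal.ofReal (‖MvPowerSeries.coeff m Φ‖ * monomialWeight w m)

/-- `m! w^m / (|m| + t)!`. -/
noncomputable def facWeight (w : Var → ℝ) (t : ℕ) (m : MultiIndex) : ℝ :=
  multiFactorial m * monomialWeight w m / (m.degree + t)!

/-- `∑ |c_m| m! w^m / (|m| + t)!` for `Φ = ∑ c_m X^m`. -/
noncomputable def facNorm (w : Var → ℝ) (t : ℕ) (Φ : VUSeries) : ℝ≥0∞ :=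
  ∑' m : MultiIndex, ENNReal.ofReal (‖MvPowerSeries.coeff m Φ‖ * facWeight w t m)

section weights

variable {w : Var → ℝ}

theorem monomialWeight_pos (hw : ∀ i, 0 < w i) (m : MultiIndex) : 0 < monomialWeight w m :=
  Finset.prod_pos fun i _ => pow_pos (hw i) _

theorem monomialWeight_add (m n : MultiIndex) :
    monomialWeight w (m + n) = monomialWeight w m * monomialWeight w n :=
  Finsupp.prod_add_index' (fun _ => pow_zero _) fun _ _ _ => pow_add _ _ _

theorem monomialWeight_single (i : Var) (e : ℕ) :
    monomialWeight w (Finsupp.single i e) = w i ^ e := by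
  simp [monomialWeight, Finsupp.prod_single_index]

theorem multiFactorial_pos (m : MultiIndex) : 0 < multiFactorial m :=
  Finset.prod_pos fun _ _ => Nat.factorial_pos _

theorem multiFactorial_add_single (m : MultiIndex) (i : Var) :
    multiFactorial (m + Finsupp.single i 1) = (m i + 1) * multiFactorial m := by
  classical
  have h1 : (m + Finsupp.single i 1).support ⊆ insert i m.support := by
    intro j hj
    by_cases h : j = i
    · simp [h]
    · simpa [Finsupp.single_apply, Ne.symm h, h] using hj
  have h2 : m.support ⊆ insert i m.support := Finset.subset_insert _ _
  rw [multiFactorial, multiFactorial, Finsupp.prod_of_support_subset _ h1 _ (by simp),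
    Finsupp.prod_of_support_subset _ h2 _ (by simp),
    ← Finset.mul_prod_erase _ _ (Finset.mem_insert_self i m.support),
    ← Finset.mul_prod_erase (insert i m.support) _ (Finset.mem_insert_self i m.support),
    ← mul_assoc]
  congr 1
  · simp [Nat.factorial_succ]
  · refine Finset.prod_congr rfl fun j hj => ?_
    have : j ≠ i := Finset.ne_of_mem_erase hj
    simp [this.symm]

/-- Raising one entry `n_i` by one multiplies `n!` by `n_i + 1` and `|n|!` by `|n| + 1`, which is at
least as large. The induction adds the units of `m` one at a time. -/
theorem multiFactorial_add_le (m n : MultiIndex) :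
    multiFactorial (m + n) * n.degree ! ≤ multiFactorial n * (m.degree + n.degree)! := by
  induction m using Finsupp.induction_linear generalizing n with
  | zero => simp
  | add f g hf hg =>
    have h1 := hf (g + n)
    have h2 := hg n
    have hpos : 0 < (g + n).degree ! := Nat.factorial_pos _
    rw [← add_assoc] at h1
    refine Nat.le_of_mul_le_mul_right ?_ hpos
    calc multiFactorial (f + g + n) * n.degree ! * (g + n).degree !
        = multiFactorial (f + g + n) * (g + n).degree ! * n.degree ! := by ring
      _ ≤ multiFactorial (g + n) * (f.degree + (g + n).degree)! * n.degree ! := by gcongr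
      _ = multiFactorial (g + n) * n.degree ! * (f.degree + (g + n).degree)! := by ring
      _ ≤ multiFactorial n * (g.degree + n.degree)! * (f.degree + (g + n).degree)! := by gcongr
      _ = _ := by simp only [map_add, add_assoc]; ring
  | single i e =>
    induction e generalizing n with
    | zero => simp
    | succ e ih =>
      have h1 := ih n
      have h2 : n i + e ≤ n.degree + e := by
        gcongr
        exact Finsupp.le_degree i n
      rw [Finsupp.single_add, add_right_comm, multiFactorial_add_single]
      simp only [map_add, Finsupp.degree_single] at h1 ⊢
      have h3 : (Finsupp.single i e + n : MultiIndex) i + 1 ≤ e + 1 + n.degree := by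
        simp; omega
      rw [show e + 1 + n.degree = (e + n.degree) + 1 by ring, Nat.factorial_succ]
      calc ((Finsupp.single i e + n : MultiIndex) i + 1) * multiFactorial (Finsupp.single i e + n) *
            n.degree !
          = ((Finsupp.single i e + n : MultiIndex) i + 1) *
            (multiFactorial (Finsupp.single i e + n) * n.degree !) := by ring
        _ ≤ (e + 1 + n.degree) * (multiFactorial n * (e + n.degree)!) := by gcongr
        _ = _ := by ring

theorem factorial_add_mul_factorial_le {a b : ℕ} (h : a ≤ b) (t : ℕ) :
    (a + t)! * b ! ≤ a ! * (b + t)! := by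
  induction t with
  | zero => simp
  | succ t ih =>
    rw [← add_assoc, ← add_assoc, Nat.factorial_succ, Nat.factorial_succ]
    calc (a + t + 1) * (a + t)! * b ! = (a + t + 1) * ((a + t)! * b !) := by ring
      _ ≤ (b + t + 1) * (a ! * (b + t)!) := by gcongr
      _ = _ := by ring

theorem facWeight_nonneg (hw : ∀ i, 0 < w i) (t : ℕ) (m : MultiIndex) : 0 ≤ facWeight w t m := by
  have := monomialWeight_pos hw m
  unfold facWeight
  positivity

theorem facWeight_add_le (hw : ∀ i, 0 < w i) (t u : ℕ) (m n : MultiIndex) :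
    facWeight w (t + u) (m + n) ≤
      monomialWeight w m * ((t ! : ℝ) / (t + u)!) * facWeight w t n := by
  have hm := monomialWeight_pos hw m
  have hn := monomialWeight_pos hw n
  -- A product of three comparisons: `(m + n)!` against factorials of degrees, then the shift of the
  -- degrees by `t`, then the further shift by `u`. The common factors are cancelled at the end.
  have key : multiFactorial (m + n) * (n.degree + t)! * (t + u)! ≤
      multiFactorial n * t ! * (m.degree + n.degree + (t + u))! := by
    have h1 := multiFactorial_add_le m n
    have h2 := factorial_add_mul_factorial_le (Nat.le_add_left n.degree m.degree) t
    have h3 := factorial_add_mul_factorial_le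
      (show t ≤ m.degree + n.degree + t from Nat.le_add_left _ _) u
    have p1 : 0 < n.degree ! := Nat.factorial_pos _
    have p2 : 0 < (m.degree + n.degree)! := Nat.factorial_pos _
    have p3 : 0 < (m.degree + n.degree + t)! := Nat.factorial_pos _
    have p4 := Nat.mul_pos (Nat.mul_pos p1 p2) p3
    refine le_of_mul_le_mul_right (a := n.degree ! * (m.degree + n.degree)! *
      (m.degree + n.degree + t)!) ?_ p4
    calc _ = (multiFactorial (m + n) * n.degree !) * ((n.degree + t)! * (m.degree + n.degree)!) *
          ((t + u)! * (m.degree + n.degree + t)!) := by ring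
      _ ≤ (multiFactorial n * (m.degree + n.degree)!) * (n.degree ! * (m.degree + n.degree + t)!) *
          (t ! * (m.degree + n.degree + t + u)!) := by gcongr
      _ = _ := by rw [add_assoc (m.degree + n.degree)]; ring
  have key' : (multiFactorial (m + n) : ℝ) * (n.degree + t)! * (t + u)! ≤
      multiFactorial n * t ! * (m.degree + n.degree + (t + u))! := by exact_mod_cast key
  have p1 : (0 : ℝ) < (n.degree + t)! := by positivity
  have p2 : (0 : ℝ) < (t + u)! := by positivity
  have p3 : (0 : ℝ) < (m.degree + n.degree + (t + u))! := by positivity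
  have : (multiFactorial (m + n) : ℝ) / (m.degree + n.degree + (t + u))! ≤
      (t ! : ℝ) / (t + u)! * (multiFactorial n / (n.degree + t)!) := by
    rw [div_mul_div_comm, div_le_div_iff₀ p3 (by positivity)]
    linarith
  unfold facWeight
  rw [monomialWeight_add, map_add]
  calc _ = (multiFactorial (m + n) : ℝ) / (m.degree + n.degree + (t + u))! *
        (monomialWeight w m * monomialWeight w n) := by ring
    _ ≤ ((t ! : ℝ) / (t + u)! * (multiFactorial n / (n.degree + t)!)) *
        (monomialWeight w m * monomialWeight w n) := by gcongr
    _ = _ := by ring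

theorem tsum_sum_antidiagonal {A : Type*} [AddMonoid A] [Finset.HasAntidiagonal A]
    (f : A → A → ℝ≥0∞) :
    ∑' n : A, ∑ p ∈ antidiagonal n, f p.1 p.2 = ∑' a, ∑' b, f a b := by
  calc ∑' n, ∑ p ∈ antidiagonal n, f p.1 p.2 = ∑' n, ∑' p : antidiagonal n, f p.1.1 p.1.2 := by
        refine tsum_congr fun n => ?_
        rw [tsum_fintype, Finset.univ_eq_attach,
          Finset.sum_attach (antidiagonal n) fun p => f p.1 p.2]
    _ = ∑' x : (Σ n : A, antidiagonal n), f x.2.1.1 x.2.1.2 :=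
        (ENNReal.tsum_sigma fun n (p : antidiagonal n) => f p.1.1 p.1.2).symm
    _ = ∑' p : A × A, f p.1 p.2 :=
        (Finset.HasAntidiagonal.sigmaAntidiagonalEquivProd (A := A)).tsum_eq
          fun p : A × A => f p.1 p.2
    _ = ∑' a, ∑' b, f a b := ENNReal.tsum_prod (f := f)

/-- The weights are submultiplicative up to the factor `t! / (t + u)!` by `facWeight_add_le`, so the
Cauchy product is bounded by the product of the sums. -/
theorem facNorm_mul_le (hw : ∀ i, 0 < w i) (t u : ℕ) (Φ Ψ : VUSeries) :
    facNorm w (t + u) (Φ * Ψ) ≤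
      l1Norm w Φ * ENNReal.ofReal ((t ! : ℝ) / (t + u)!) * facNorm w t Ψ := by
  classical
  set c := ENNReal.ofReal ((t ! : ℝ) / (t + u)!) with hc
  set F : MultiIndex → ℝ≥0∞ := fun m =>
    ENNReal.ofReal (‖MvPowerSeries.coeff m Φ‖ * monomialWeight w m) with hF
  set G : MultiIndex → ℝ≥0∞ := fun m =>
    ENNReal.ofReal (‖MvPowerSeries.coeff m Ψ‖ * facWeight w t m) with hG
  have hterm : ∀ m : MultiIndex, ENNReal.ofReal
      (‖MvPowerSeries.coeff m (Φ * Ψ)‖ * facWeight w (t + u) m) ≤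
      ∑ p ∈ antidiagonal m, F p.1 * c * G p.2 := by
    intro m
    have h1 : ‖MvPowerSeries.coeff m (Φ * Ψ)‖ * facWeight w (t + u) m ≤
        ∑ p ∈ antidiagonal m, (‖MvPowerSeries.coeff p.1 Φ‖ * monomialWeight w p.1) *
          ((t ! : ℝ) / (t + u)!) * (‖MvPowerSeries.coeff p.2 Ψ‖ * facWeight w t p.2) := by
      rw [MvPowerSeries.coeff_mul]
      refine (mul_le_mul_of_nonneg_right (norm_sum_le _ _) (facWeight_nonneg hw _ _)).trans ?_
      rw [Finset.sum_mul]
      refine Finset.sum_le_sum fun p hp => ?_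
      rw [← mem_antidiagonal.1 hp, norm_mul]
      refine (mul_le_mul_of_nonneg_left (facWeight_add_le hw t u p.1 p.2) (by positivity)).trans
        (le_of_eq (by ring))
    refine (ENNReal.ofReal_le_ofReal h1).trans ?_
    rw [ENNReal.ofReal_sum_of_nonneg]
    · refine Finset.sum_le_sum fun p _ => ?_
      have := monomialWeight_pos hw p.1
      rw [ENNReal.ofReal_mul (by positivity), ENNReal.ofReal_mul (by positivity)]
    · intro p _
      have := monomialWeight_pos hw p.1
      have := facWeight_nonneg hw t p.2
      positivity
  calc facNorm w (t + u) (Φ * Ψ) ≤ ∑' m, ∑ p ∈ antidiagonal m, F p.1 * c * G p.2 :=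
        ENNReal.tsum_le_tsum hterm
    _ = ∑' m, ∑' n, F m * c * G n := tsum_sum_antidiagonal fun m n => F m * c * G n
    _ = _ := by
        simp_rw [ENNReal.tsum_mul_left, ENNReal.tsum_mul_right]
        rfl

/-- Reindexing by `m ↦ m + e_i`: the factor `m_i + 1` completes `m!` to `(m + e_i)!`, and the shift
of the level keeps `|m| + t + 1` unchanged. Only `w_i` is left over; the inequality comes from the
monomials free of `X_i`, which are lost. -/
theorem facNorm_pderiv_le (hw : ∀ i, 0 < w i) (t : ℕ) (i : Var) (Φ : VUSeries) :
    facNorm w (t + 1) (MvPowerSeries.pderiv ℂ i Φ) ≤ ENNReal.ofReal (w i)⁻¹ * facNorm w t Φ := by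
  set G : MultiIndex → ℝ≥0∞ := fun m =>
    ENNReal.ofReal (‖MvPowerSeries.coeff m Φ‖ * facWeight w t m) with hG
  have hterm : ∀ m : MultiIndex, ENNReal.ofReal
      (‖MvPowerSeries.coeff m (MvPowerSeries.pderiv ℂ i Φ)‖ * facWeight w (t + 1) m) =
      ENNReal.ofReal (w i)⁻¹ * G (m + Finsupp.single i 1) := by
    intro m
    rw [hG, ← ENNReal.ofReal_mul (inv_nonneg.2 (hw i).le), MvPowerSeries.coeff_pderiv, norm_mul]
    have h1 : ‖((m i : ℂ) + 1)‖ = (m i : ℝ) + 1 := by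
      rw [← Nat.cast_add_one, Complex.norm_natCast]; push_cast; rfl
    rw [h1]
    unfold facWeight
    rw [multiFactorial_add_single, monomialWeight_add, monomialWeight_single, map_add,
      Finsupp.degree_single, show m.degree + 1 + t = m.degree + (t + 1) by ring]
    have := (hw i).ne'
    congr 1
    push_cast
    field_simp
  unfold facNorm
  simp_rw [hterm]
  rw [ENNReal.tsum_mul_left]
  have hinj : Function.Injective fun m : MultiIndex => m + (Finsupp.single i 1 : MultiIndex) :=
    fun _ _ h => add_right_cancel h
  exact mul_le_mul_right (ENNReal.tsum_comp_le_tsum_of_injective hinj G) _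

theorem facNorm_add_le (hw : ∀ i, 0 < w i) (t : ℕ) (Φ Ψ : VUSeries) :
    facNorm w t (Φ + Ψ) ≤ facNorm w t Φ + facNorm w t Ψ := by
  unfold facNorm
  rw [← ENNReal.tsum_add]
  refine ENNReal.tsum_le_tsum fun m => ?_
  have := facWeight_nonneg hw t m
  rw [← ENNReal.ofReal_add (by positivity) (by positivity), map_add, ← add_mul]
  exact ENNReal.ofReal_le_ofReal (mul_le_mul_of_nonneg_right (norm_add_le _ _) this)

theorem facNorm_sum_le (hw : ∀ i, 0 < w i) (t : ℕ) {ι : Type*} (s : Finset ι) (Φ : ι → VUSeries) :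
    facNorm w t (∑ i ∈ s, Φ i) ≤ ∑ i ∈ s, facNorm w t (Φ i) := by
  classical
  induction s using Finset.induction_on with
  | empty => simp [facNorm]
  | insert i s hi ih =>
    rw [Finset.sum_insert hi, Finset.sum_insert hi]
    exact (facNorm_add_le hw t _ _).trans (by gcongr)

theorem facNorm_smul (t : ℕ) (c : ℂ) (Φ : VUSeries) :
    facNorm w t (c • Φ) = ENNReal.ofReal ‖c‖ * facNorm w t Φ := by
  unfold facNorm
  rw [← ENNReal.tsum_mul_left]
  refine tsum_congr fun m => ?_
  rw [← ENNReal.ofReal_mul (norm_nonneg _), map_smul, smul_eq_mul, norm_mul, mul_assoc]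

end weights

/-! ### Supports -/

/-- All monomials of `Φ` involve only `V₀`, `V₁` and `U_h` with `h ≤ N`. -/
def SupportedSeries (N : ℕ) (Φ : VUSeries) : Prop :=
  ∀ m : MultiIndex, MvPowerSeries.coeff m Φ ≠ 0 → Supported N m

namespace SupportedSeries

variable {N : ℕ} {Φ Ψ : VUSeries}

theorem mono {M : ℕ} (h : SupportedSeries N Φ) (hNM : N ≤ M) : SupportedSeries M Φ :=
  fun m hm i hi => (h m hm i hi).trans hNM

theorem mul (hΦ : SupportedSeries N Φ) (hΨ : SupportedSeries N Ψ) :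
    SupportedSeries N (Φ * Ψ) := by
  classical
  intro m hm h hh
  rw [MvPowerSeries.coeff_mul] at hm
  obtain ⟨p, hp, hp'⟩ := Finset.exists_ne_zero_of_sum_ne_zero hm
  rw [← mem_antidiagonal.1 hp, Finsupp.add_apply] at hh
  by_cases h0 : p.1 (U h) = 0
  · exact hΨ _ (right_ne_zero_of_mul hp') h (by omega)
  · exact hΦ _ (left_ne_zero_of_mul hp') h h0

theorem smul (h : SupportedSeries N Φ) (c : ℂ) : SupportedSeries N (c • Φ) := by
  intro m hm
  rw [map_smul, smul_eq_mul] at hm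
  exact h m (right_ne_zero_of_mul hm)

theorem sum {ι : Type*} {s : Finset ι} {f : ι → VUSeries}
    (h : ∀ i ∈ s, SupportedSeries N (f i)) : SupportedSeries N (∑ i ∈ s, f i) := by
  intro m hm
  rw [map_sum] at hm
  obtain ⟨i, hi, hi'⟩ := Finset.exists_ne_zero_of_sum_ne_zero hm
  exact h i hi m hi'

theorem zero : SupportedSeries N 0 := fun _ hm => absurd (map_zero _) hm

theorem pderiv (h : SupportedSeries N Φ) (i : Var) :
    SupportedSeries N (MvPowerSeries.pderiv ℂ i Φ) := by
  intro m hm k hk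
  rw [MvPowerSeries.coeff_pderiv] at hm
  refine h _ (left_ne_zero_of_mul hm) k ?_
  rw [Finsupp.add_apply]
  omega

theorem majorant (R ρ : ℝ) (N : ℕ) (F : (Var → ℂ) → ℂ) :
    SupportedSeries N (majorant R ρ N F) := by
  intro m hm
  by_contra h
  exact hm (if_neg h)

end SupportedSeries

/-! ### The norms of the spaces `E` and `G` with values in `[0, ∞]` -/

/-- `exp(-σ r_b(α) ρ) ∑ |c_m| m! w^m / (|m| + α)!` for `Φ = ∑ c_m X^m`. -/
noncomputable def expNorm (b σ ρ : ℝ) (w : Var → ℝ) (α : ℕ) (Φ : VUSeries) : ℝ≥0∞ :=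
  ENNReal.ofReal (Real.exp (-(σ * rSum b α * ρ))) * facNorm w α Φ

/-- The sum of the norms of the components of `Ψ`, weighted by the powers of `Wbar`. -/
noncomputable def totalNorm (b σ ρ Wbar : ℝ) (w : Var → ℝ) (Ψ : WSeries) : ℝ≥0∞ :=
  ∑' α : ℕ, expNorm b σ ρ w α (component Ψ α) * ENNReal.ofReal (Wbar ^ α)

section transfer

variable {b σ Vbar₀ Vbar₁ δbar ρ : ℝ}

theorem radius_pos (h₀ : 0 < Vbar₀) (h₁ : 0 < Vbar₁) (hδ : 0 < δbar) (i : Var) :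
    0 < radius b Vbar₀ Vbar₁ δbar i := by
  rcases i with i | h
  · simp only [radius]
    split_ifs <;> assumption
  · simp only [radius]
    positivity

theorem termE_nonneg (hw : ∀ i, 0 < radius b Vbar₀ Vbar₁ δbar i)
    (α : ℕ) (Φ : VUSeries) (m : MultiIndex) :
    0 ≤ termE b σ Vbar₀ Vbar₁ δbar ρ α Φ m := by
  have : 0 < m.prod fun i e => radius b Vbar₀ Vbar₁ δbar i ^ e := monomialWeight_pos hw m
  unfold termE
  positivity

theorem tsum_ofReal_termE (α : ℕ) (Φ : VUSeries) :
    ∑' m, ENNReal.ofReal (termE b σ Vbar₀ Vbar₁ δbar ρ α Φ m) =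
      expNorm b σ ρ (radius b Vbar₀ Vbar₁ δbar) α Φ := by
  unfold expNorm facNorm
  rw [← ENNReal.tsum_mul_left]
  refine tsum_congr fun m => ?_
  rw [← ENNReal.ofReal_mul (Real.exp_pos _).le]
  congr 1
  unfold termE expCoeff facWeight monomialWeight
  rw [norm_mul, Complex.norm_natCast, Real.exp_neg]
  ring

theorem MemE.ofReal_normE (hw : ∀ i, 0 < radius b Vbar₀ Vbar₁ δbar i)
    {α : ℕ} {Φ : VUSeries} (h : MemE b σ Vbar₀ Vbar₁ δbar ρ α Φ) :
    ENNReal.ofReal (normE b σ Vbar₀ Vbar₁ δbar ρ α Φ) =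
      expNorm b σ ρ (radius b Vbar₀ Vbar₁ δbar) α Φ := by
  rw [← tsum_ofReal_termE, normE, ENNReal.ofReal_tsum_of_nonneg (termE_nonneg hw α Φ) h.summable]

theorem memE_of_expNorm_ne_top (hw : ∀ i, 0 < radius b Vbar₀ Vbar₁ δbar i)
    {α : ℕ} {Φ : VUSeries} (hs : SupportedSeries α Φ)
    (h : expNorm b σ ρ (radius b Vbar₀ Vbar₁ δbar) α Φ ≠ ⊤) :
    MemE b σ Vbar₀ Vbar₁ δbar ρ α Φ := by
  refine ⟨hs, ?_⟩
  rw [← tsum_ofReal_termE] at h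
  simpa [ENNReal.toReal_ofReal (termE_nonneg hw α Φ _)] using ENNReal.summable_toReal h

theorem normE_nonneg (hw : ∀ i, 0 < radius b Vbar₀ Vbar₁ δbar i)
    (α : ℕ) (Φ : VUSeries) : 0 ≤ normE b σ Vbar₀ Vbar₁ δbar ρ α Φ :=
  tsum_nonneg (termE_nonneg hw α Φ)

theorem MemG.ofReal_normG (hw : ∀ i, 0 < radius b Vbar₀ Vbar₁ δbar i)
    {Wbar : ℝ} (hW : 0 < Wbar) {Ψ : WSeries}
    (h : MemG b σ Vbar₀ Vbar₁ δbar ρ Wbar Ψ) :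
    ENNReal.ofReal (normG b σ Vbar₀ Vbar₁ δbar ρ Wbar Ψ) =
      totalNorm b σ ρ Wbar (radius b Vbar₀ Vbar₁ δbar) Ψ := by
  rw [normG, ENNReal.ofReal_tsum_of_nonneg _ h.summable]
  · refine tsum_congr fun α => ?_
    rw [ENNReal.ofReal_mul (normE_nonneg hw α _), (h.memE α).ofReal_normE hw]
  · exact fun α => mul_nonneg (normE_nonneg hw α _) (by positivity)

theorem memG_of_totalNorm_ne_top (hw : ∀ i, 0 < radius b Vbar₀ Vbar₁ δbar i)
    {Wbar : ℝ} (hW : 0 < Wbar) {Ψ : WSeries}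
    (hs : ∀ α, SupportedSeries α (component Ψ α))
    (h : totalNorm b σ ρ Wbar (radius b Vbar₀ Vbar₁ δbar) Ψ ≠ ⊤) :
    MemG b σ Vbar₀ Vbar₁ δbar ρ Wbar Ψ := by
  have hE : ∀ α, MemE b σ Vbar₀ Vbar₁ δbar ρ α (component Ψ α) := by
    refine fun α => memE_of_expNorm_ne_top hw (hs α) fun htop => ?_
    have := ENNReal.ne_top_of_tsum_ne_top h α
    rw [htop, ENNReal.top_mul] at this
    · exact this rfl
    · simpa using pow_pos hW α
  refine ⟨hE, ?_⟩
  convert ENNReal.summable_toReal h using 2 with α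
  rw [← (hE α).ofReal_normE hw, ENNReal.toReal_mul, ENNReal.toReal_ofReal (normE_nonneg hw α _),
    ENNReal.toReal_ofReal (by positivity)]

/-- Estimates are made in `[0, ∞]`, where every sum exists and can be rearranged. A finite bound
there yields both membership and the real inequality. -/
theorem memG_and_normG_le (hw : ∀ i, 0 < radius b Vbar₀ Vbar₁ δbar i)
    {Wbar C : ℝ} (hW : 0 < Wbar) (hC : 0 ≤ C) {Ψ Θ : WSeries}
    (hΨ : MemG b σ Vbar₀ Vbar₁ δbar ρ Wbar Ψ) (hs : ∀ α, SupportedSeries α (component Θ α))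
    (h : totalNorm b σ ρ Wbar (radius b Vbar₀ Vbar₁ δbar) Θ ≤
      ENNReal.ofReal C * totalNorm b σ ρ Wbar (radius b Vbar₀ Vbar₁ δbar) Ψ) :
    MemG b σ Vbar₀ Vbar₁ δbar ρ Wbar Θ ∧
      normG b σ Vbar₀ Vbar₁ δbar ρ Wbar Θ ≤ C * normG b σ Vbar₀ Vbar₁ δbar ρ Wbar Ψ := by
  have hn : 0 ≤ normG b σ Vbar₀ Vbar₁ δbar ρ Wbar Ψ :=
    tsum_nonneg fun α => mul_nonneg (normE_nonneg hw α _) (by positivity)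
  rw [← hΨ.ofReal_normG hw hW, ← ENNReal.ofReal_mul hC] at h
  have hΘ := memG_of_totalNorm_ne_top hw hW hs (ne_top_of_le_ne_top ENNReal.ofReal_ne_top h)
  refine ⟨hΘ, ?_⟩
  rw [← hΘ.ofReal_normG hw hW] at h
  exact (ENNReal.ofReal_le_ofReal_iff (by positivity)).1 h

end transfer

/-! ### The components of `B ∂_W^{-s} X` -/

theorem coeff_intW_iterate (s n : ℕ) (X : WSeries) :
    PowerSeries.coeff n (intW^[s] X) =
      if n < s then 0 else (((n - s)! : ℂ) / n !) • PowerSeries.coeff (n - s) X := by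
  induction s generalizing n with
  | zero => simp [div_self (show (n ! : ℂ) ≠ 0 by exact_mod_cast (Nat.factorial_ne_zero n))]
  | succ s ih =>
    rw [Function.iterate_succ_apply', intW, PowerSeries.coeff_mk]
    rcases n with _ | n
    · simp
    · rw [if_neg (Nat.succ_ne_zero n), Nat.add_sub_cancel, ih]
      by_cases h : n < s
      · simp [h]
      · rw [if_neg h, if_neg (by omega), Nat.add_sub_add_right, smul_smul]
        congr 1
        have h1 : (n ! : ℂ) ≠ 0 := by exact_mod_cast Nat.factorial_ne_zero n
        have h2 : ((n : ℂ) + 1) ≠ 0 := by exact_mod_cast Nat.succ_ne_zero n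
        rw [Nat.factorial_succ]
        push_cast
        field_simp

theorem component_mul_intW_iterate (s α : ℕ) (B X : WSeries) :
    component (B * intW^[s] X) α = ∑ p ∈ antidiagonal α,
      if p.2 < s then 0 else
        ((α ! : ℂ) / (p.1 ! * p.2 !)) • (component B p.1 * component X (p.2 - s)) := by
  rw [component, PowerSeries.coeff_mul, Finset.smul_sum]
  refine Finset.sum_congr rfl fun p _ => ?_
  rw [coeff_intW_iterate]
  split_ifs with h
  · simp
  · have h1 : (p.1 ! : ℂ) ≠ 0 := by exact_mod_cast Nat.factorial_ne_zero _
    rw [mul_smul_comm]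
    simp only [component, smul_mul_smul_comm, smul_smul]
    congr 1
    field_simp

theorem component_seriesB (R ρ : ℝ) (β : ℂ × ℂ × ℂ × ℂ → ℂ) (α : ℕ) :
    component (seriesB R ρ β) α = majorant R ρ 0 (wCoeff β α) := by
  have h1 : (α ! : ℂ) ≠ 0 := by exact_mod_cast Nat.factorial_ne_zero _
  simp [component, seriesB, smul_smul, h1]

theorem component_opD (R ρ : ℝ) (F : ℕ → (Var → ℂ) → ℂ) (Ψ : WSeries) (α : ℕ) :
    component (opD R ρ F Ψ) α = ∑ j ∈ Finset.range (α + 1),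
      majorant R ρ (α + 1) (F j) * MvPowerSeries.pderiv ℂ (U j) (component Ψ α) := by
  have h1 : (α ! : ℂ) ≠ 0 := by exact_mod_cast Nat.factorial_ne_zero _
  simp [component, opD, smul_smul, h1]

/-- The majorants in `(𝔻Ψ)_γ` involve `U_{γ+1}`, one variable too many for the index `γ`; a single
integration in `W` makes room for it, hence `1 ≤ s`. -/
theorem supported_component {R ρ : ℝ} {β : ℂ × ℂ × ℂ × ℂ → ℂ} {F : ℕ → (Var → ℂ) → ℂ}
    {Ψ : WSeries} (hΨ : ∀ α, SupportedSeries α (component Ψ α)) {s : ℕ} (hs : 1 ≤ s) (α : ℕ) :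
    SupportedSeries α (component (seriesB R ρ β * intW^[s] (opD R ρ F Ψ)) α) := by
  rw [component_mul_intW_iterate]
  refine SupportedSeries.sum fun p hp => ?_
  rw [mem_antidiagonal] at hp
  split_ifs with h
  · exact .zero
  · rw [component_seriesB, component_opD]
    refine ((SupportedSeries.majorant _ _ _ _).mono (by omega) |>.mul ?_).smul _
    refine SupportedSeries.sum fun j _ => .mul ?_ ?_
    · exact (SupportedSeries.majorant _ _ _ _).mono (by omega)
    · exact ((hΨ _).pderiv _).mono (by omega)

/-! ### The norm of `B ∂_W^{-s} 𝔻` -/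

theorem rSum_succ (b : ℝ) (n : ℕ) : rSum b (n + 1) = rSum b n + 1 / ((n : ℝ) + 2) ^ b := by
  rw [rSum, Finset.sum_range_succ, ← rSum]
  congr 3
  push_cast
  ring

theorem rSum_mono (b : ℝ) : Monotone (rSum b) := by
  refine monotone_nat_of_le_succ fun n => ?_
  rw [rSum_succ]
  have : (0 : ℝ) ≤ 1 / ((n : ℝ) + 2) ^ b := by positivity
  linarith

/-- The derivative brings `Ψ_γ` to level `γ + 1`; multiplication by the majorant then climbs the
remaining `u` levels and earns the factorial quotient. -/
theorem facNorm_component_opD_le {w : Var → ℝ} (hw : ∀ i, 0 < w i) {R ρ : ℝ}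
    {F : ℕ → (Var → ℂ) → ℂ} (Ψ : WSeries) (γ u : ℕ) {f : ℝ} (hf : 0 ≤ f)
    (hF : ∑ j ∈ Finset.range (γ + 1),
      l1Norm w (majorant R ρ (γ + 1) (F j)) * ENNReal.ofReal (w (U j))⁻¹ ≤ ENNReal.ofReal f) :
    facNorm w (γ + 1 + u) (component (opD R ρ F Ψ) γ) ≤
      ENNReal.ofReal (f * ((γ + 1)! / (γ + 1 + u)!)) * facNorm w γ (component Ψ γ) := by
  rw [component_opD]
  refine (facNorm_sum_le hw _ _ _).trans ?_
  calc _ ≤ ∑ j ∈ Finset.range (γ + 1), l1Norm w (majorant R ρ (γ + 1) (F j)) *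
          ENNReal.ofReal (((γ + 1)! : ℝ) / (γ + 1 + u)!) *
          (ENNReal.ofReal (w (U j))⁻¹ * facNorm w γ (component Ψ γ)) := by
        refine Finset.sum_le_sum fun j _ => (facNorm_mul_le hw (γ + 1) u _ _).trans ?_
        exact mul_le_mul_right (facNorm_pderiv_le hw γ (U j) _) _
    _ = (∑ j ∈ Finset.range (γ + 1),
          l1Norm w (majorant R ρ (γ + 1) (F j)) * ENNReal.ofReal (w (U j))⁻¹) *
          ENNReal.ofReal (((γ + 1)! : ℝ) / (γ + 1 + u)!) * facNorm w γ (component Ψ γ) := by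
        rw [Finset.sum_mul, Finset.sum_mul]
        exact Finset.sum_congr rfl fun j _ => by ring
    _ ≤ _ := by
        rw [ENNReal.ofReal_mul hf]
        gcongr

theorem ofReal_mul_regroup {e₁ e₂ A B C D : ℝ} (h₁ : 0 ≤ e₁) (hA : 0 ≤ A) (hB : 0 ≤ B)
    (hC : 0 ≤ C) (hD : 0 ≤ D) (x : ℝ≥0∞) :
    ENNReal.ofReal (e₁ * e₂) * (ENNReal.ofReal A * (ENNReal.ofReal B * ENNReal.ofReal C *
      (ENNReal.ofReal D * x))) = ENNReal.ofReal (e₁ * A * B * C * D) * (ENNReal.ofReal e₂ * x) := by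
  rw [ENNReal.ofReal_mul h₁, ENNReal.ofReal_mul' hD, ENNReal.ofReal_mul' hC, ENNReal.ofReal_mul' hB,
    ENNReal.ofReal_mul' hA]
  ring

theorem tsum_ofReal_geometric {q : ℝ} (h0 : 0 ≤ q) (h1 : q < 1) :
    ∑' n : ℕ, ENNReal.ofReal (q ^ n) = ENNReal.ofReal (1 - q)⁻¹ := by
  rw [← ENNReal.ofReal_tsum_of_nonneg (fun n => by positivity)
    (summable_geometric_of_lt_one h0 h1), tsum_geometric_of_lt_one h0 h1]

/-- The core estimate, with the sizes of the majorants as data: `hB` is a Cauchy bound in `w`, `hF`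
bounds the operator on the component `γ`, and `hbound` says that factorial and exponential gains
together absorb both, uniformly in `γ`. -/
theorem totalNorm_mul_intW_opD_le {b σ ρ Wbar q KB K R : ℝ} {w : Var → ℝ} (hw : ∀ i, 0 < w i)
    (hσ : 0 < σ) (hρ : 0 < ρ) (hW : 0 < Wbar) (hq : 0 ≤ q) (hqW : q * Wbar < 1)
    (hKB : 0 ≤ KB) (hK : 0 ≤ K) {s : ℕ} (hs : 1 ≤ s) {β : ℂ × ℂ × ℂ × ℂ → ℂ}
    {F : ℕ → (Var → ℂ) → ℂ} {f : ℕ → ℝ} (hf : ∀ γ, 0 ≤ f γ)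
    (hB : ∀ n, l1Norm w (majorant R ρ 0 (wCoeff β n)) ≤ ENNReal.ofReal (KB * n ! * q ^ n))
    (hF : ∀ γ, ∑ j ∈ Finset.range (γ + 1),
      l1Norm w (majorant R ρ (γ + 1) (F j)) * ENNReal.ofReal (w (U j))⁻¹ ≤ ENNReal.ofReal (f γ))
    (hbound : ∀ γ : ℕ, KB * (f γ * ((γ + 1)! / (γ + s)!)) *
      Real.exp (-(σ * (1 / ((γ : ℝ) + 2) ^ b) * ρ)) ≤ K)
    (Ψ : WSeries) :
    totalNorm b σ ρ Wbar w (seriesB R ρ β * intW^[s] (opD R ρ F Ψ)) ≤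
      ENNReal.ofReal (K * (1 - q * Wbar)⁻¹ * Wbar ^ s) * totalNorm b σ ρ Wbar w Ψ := by
  -- One integration pays for the derivative in `𝔻`; the other `u` produce the gain.
  obtain ⟨u, rfl⟩ : ∃ u, s = 1 + u := ⟨s - 1, by omega⟩
  set T : ℕ → ℝ≥0∞ := fun γ =>
    expNorm b σ ρ w γ (component Ψ γ) * ENNReal.ofReal (Wbar ^ γ) with hT
  set g : ℕ → ℕ → ℝ≥0∞ := fun n l => ENNReal.ofReal (K * Wbar ^ (1 + u)) *
    ENNReal.ofReal ((q * Wbar) ^ n) * (if l < 1 + u then 0 else T (l - (1 + u))) with hg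
  have hterm : ∀ n γ : ℕ, expNorm b σ ρ w (n + (γ + (1 + u)))
      ((((n + (γ + (1 + u)))! : ℂ) / (n ! * (γ + (1 + u))!)) •
        (component (seriesB R ρ β) n * component (opD R ρ F Ψ) γ)) ≤
      ENNReal.ofReal (K * q ^ n) * expNorm b σ ρ w γ (component Ψ γ) := by
    intro n γ
    set P := (component (seriesB R ρ β) n * component (opD R ρ F Ψ) γ) with hP
    set t := γ + (1 + u) with ht
    have h1 : facNorm w (n + t) P ≤ ENNReal.ofReal (KB * n ! * q ^ n) *
        ENNReal.ofReal ((t ! : ℝ) / (n + t)!) *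
        (ENNReal.ofReal (f γ * ((γ + 1)! / t !)) * facNorm w γ (component Ψ γ)) := by
      rw [add_comm n t]
      refine (facNorm_mul_le hw t n _ _).trans ?_
      rw [component_seriesB]
      gcongr
      · exact hB n
      · have := facNorm_component_opD_le hw Ψ γ u (hf γ) (hF γ)
        rwa [add_assoc γ 1 u] at this
    -- Since `n + t ≥ γ + 1`, at least the increment of `r_b` from `γ` to `γ + 1` is available; no
    -- more is used.
    have hexp : Real.exp (-(σ * rSum b (n + t) * ρ)) ≤
        Real.exp (-(σ * (1 / ((γ : ℝ) + 2) ^ b) * ρ)) * Real.exp (-(σ * rSum b γ * ρ)) := by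
      rw [← Real.exp_add, Real.exp_le_exp]
      have h2 : rSum b (γ + 1) ≤ rSum b (n + t) := rSum_mono b (by omega)
      rw [rSum_succ] at h2
      have h3 : σ * ρ * (rSum b γ + 1 / ((γ : ℝ) + 2) ^ b) ≤ σ * ρ * rSum b (n + t) := by gcongr
      linarith
    have hnorm : ‖(((n + t)! : ℂ) / (n ! * t !))‖ = ((n + t)! : ℝ) / (n ! * t !) := by
      rw [norm_div, norm_mul, Complex.norm_natCast, Complex.norm_natCast, Complex.norm_natCast]
    unfold expNorm
    rw [facNorm_smul, hnorm]
    calc _ ≤ ENNReal.ofReal (Real.exp (-(σ * (1 / ((γ : ℝ) + 2) ^ b) * ρ)) *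
            Real.exp (-(σ * rSum b γ * ρ))) * (ENNReal.ofReal (((n + t)! : ℝ) / (n ! * t !)) *
            (ENNReal.ofReal (KB * n ! * q ^ n) * ENNReal.ofReal ((t ! : ℝ) / (n + t)!) *
            (ENNReal.ofReal (f γ * ((γ + 1)! / t !)) * facNorm w γ (component Ψ γ)))) := by
          gcongr
      _ = ENNReal.ofReal (Real.exp (-(σ * (1 / ((γ : ℝ) + 2) ^ b) * ρ)) *
            (((n + t)! : ℝ) / (n ! * t !)) * (KB * n ! * q ^ n) * ((t ! : ℝ) / (n + t)!) *
            (f γ * ((γ + 1)! / t !))) * (ENNReal.ofReal (Real.exp (-(σ * rSum b γ * ρ))) *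
            facNorm w γ (component Ψ γ)) := by
          have := hf γ
          exact ofReal_mul_regroup (by positivity) (by positivity) (by positivity) (by positivity)
            (by positivity) _
      _ ≤ _ := by
          refine mul_le_mul_left (ENNReal.ofReal_le_ofReal ?_) _
          have p1 : (0 : ℝ) < n ! := by positivity
          have p2 : (0 : ℝ) < t ! := by positivity
          have p3 : (0 : ℝ) < (n + t)! := by positivity
          calc _ = KB * (f γ * ((γ + 1)! / t !)) *
                Real.exp (-(σ * (1 / ((γ : ℝ) + 2) ^ b) * ρ)) * q ^ n := by
                field_simp
            _ ≤ K * q ^ n := by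
                gcongr
                exact hbound γ
  have hα : ∀ α, expNorm b σ ρ w α
      (component (seriesB R ρ β * intW^[1 + u] (opD R ρ F Ψ)) α) * ENNReal.ofReal (Wbar ^ α) ≤
      ∑ p ∈ antidiagonal α, g p.1 p.2 := by
    intro α
    rw [component_mul_intW_iterate]
    refine (mul_le_mul_left (mul_le_mul_right (facNorm_sum_le hw _ _ _) _) _).trans ?_
    rw [Finset.mul_sum, Finset.sum_mul]
    refine Finset.sum_le_sum fun p hp => ?_
    rw [mem_antidiagonal] at hp
    simp only [hg]
    split_ifs with h
    · simp [facNorm]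
    · obtain ⟨γ, hγ⟩ : ∃ γ, p.2 = γ + (1 + u) := ⟨p.2 - (1 + u), by omega⟩
      have := hterm p.1 γ
      rw [← hγ, hp] at this
      rw [hγ, Nat.add_sub_cancel, ← hγ]
      refine (mul_le_mul_left this _).trans (le_of_eq ?_)
      rw [hT, ← hp, hγ, pow_add, pow_add, mul_pow, ENNReal.ofReal_mul (by positivity),
        ENNReal.ofReal_mul (by positivity), ENNReal.ofReal_mul (by positivity),
        ENNReal.ofReal_mul (by positivity), ENNReal.ofReal_mul (by positivity)]
      ring
  -- The first `1 + u` terms vanish, so the shift caused by the integrations does not change the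
  -- sum.
  have hshift : ∑' l : ℕ, (if l < 1 + u then 0 else T (l - (1 + u))) = ∑' γ, T γ := by
    rw [← ENNReal.summable.sum_add_tsum_nat_add' (k := 1 + u) (f := fun l : ℕ =>
      if l < 1 + u then 0 else T (l - (1 + u))), Finset.sum_eq_zero, zero_add]
    · exact tsum_congr fun γ => by simp
    · intro i hi
      rw [if_pos (Finset.mem_range.1 hi)]
  calc _ ≤ ∑' α, ∑ p ∈ antidiagonal α, g p.1 p.2 := ENNReal.tsum_le_tsum hα
    _ = ∑' n, ∑' l, g n l := tsum_sum_antidiagonal g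
    _ = ENNReal.ofReal (K * Wbar ^ (1 + u)) * ENNReal.ofReal (1 - q * Wbar)⁻¹ * ∑' γ, T γ := by
        simp_rw [hg, ENNReal.tsum_mul_left, ENNReal.tsum_mul_right, hshift]
        rw [ENNReal.tsum_mul_left,
          tsum_ofReal_geometric (by positivity) hqW]
    _ = _ := by
        rw [← ENNReal.ofReal_mul (by positivity)]
        congr 2
        ring

open Metric

/-! ### Separately holomorphic functions of two variables -/

/-- The Schwarz lemma twice: applied to `g` it bounds `dslope g t` on the disc, applied to `dslope g
t` it gives a Lipschitz bound at `t`, where the value is the derivative. The constant depends only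
on `M` and `r`, which makes it uniform in a parameter. -/
theorem dist_slope_deriv_le {g : ℂ → ℂ} {t : ℂ} {r M : ℝ} (hr : 0 < r)
    (hg : DifferentiableOn ℂ g (ball t r)) (hM : ∀ z ∈ ball t r, ‖g z‖ ≤ M) {h : ℂ} (h0 : h ≠ 0)
    (hh : ‖h‖ < r) :
    dist (h⁻¹ * (g (t + h) - g t)) (deriv g t) ≤ (2 * ((2 * M + 1) / r) + 1) / r * ‖h‖ := by
  have ht : t ∈ ball t r := mem_ball_self hr
  have hth : t + h ∈ ball t r := by simpa [dist_eq_norm] using hh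
  set B := (2 * M + 1) / r with hB
  have hmaps : Set.MapsTo g (ball t r) (closedBall (g t) (2 * M + 1)) := fun z hz => by
    rw [mem_closedBall, dist_eq_norm]
    linarith [norm_sub_le (g z) (g t), hM z hz, hM t ht]
  have hψ : DifferentiableOn ℂ (dslope g t) (ball t r) :=
    (Complex.differentiableOn_dslope (isOpen_ball.mem_nhds ht)).2 hg
  have hψB : ∀ z ∈ ball t r, ‖dslope g t z‖ ≤ B := fun z hz =>
    Complex.norm_dslope_le_div_of_mapsTo_ball hg hmaps hz
  have hmaps' : Set.MapsTo (dslope g t) (ball t r) (closedBall (dslope g t t) (2 * B + 1)) :=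
    fun z hz => by
      rw [mem_closedBall, dist_eq_norm]
      linarith [norm_sub_le (dslope g t z) (dslope g t t), hψB z hz, hψB t ht]
  have := Complex.dist_le_div_mul_dist_of_mapsTo_ball hψ hmaps' hth
  rw [dslope_same, dslope_of_ne _ (by simpa using h0), slope_def_field] at this
  simpa [dist_eq_norm, div_eq_inv_mul] using this

/-- The difference quotients in `t` are holomorphic in the parameter `s` and converge uniformly on
`U`, so the limit is holomorphic in `s`. No joint regularity is needed. -/
theorem differentiableOn_deriv_param {f : ℂ → ℂ → ℂ} {U : Set ℂ} (hU : IsOpen U) {t : ℂ} {r M : ℝ}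
    (hr : 0 < r) (hs : ∀ z ∈ ball t r, DifferentiableOn ℂ (fun s => f s z) U)
    (ht : ∀ s ∈ U, DifferentiableOn ℂ (f s) (ball t r))
    (hM : ∀ s ∈ U, ∀ z ∈ ball t r, ‖f s z‖ ≤ M) :
    DifferentiableOn ℂ (fun s => deriv (f s) t) U := by
  have hsmall : ∀ ε > 0, ∀ᶠ h in nhdsWithin (0 : ℂ) {0}ᶜ, h ≠ 0 ∧ ‖h‖ < ε := fun ε hε => by
    refine (eventually_mem_nhdsWithin).and (nhdsWithin_le_nhds ?_)
    filter_upwards [ball_mem_nhds (0 : ℂ) hε] with h hh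
    simpa using hh
  have hlim : TendstoUniformlyOn (fun h s => h⁻¹ * (f s (t + h) - f s t)) (fun s => deriv (f s) t)
      (nhdsWithin (0 : ℂ) {0}ᶜ) U := by
    rw [Metric.tendstoUniformlyOn_iff]
    intro ε hε
    set C := |(2 * ((2 * M + 1) / r) + 1) / r| + 1 with hC
    have hCpos : 0 < C := by positivity
    filter_upwards [hsmall r hr, hsmall (ε / C) (by positivity)] with h h1 h2 s hsU
    rw [dist_comm]
    refine (dist_slope_deriv_le hr (ht s hsU) (hM s hsU) h1.1 h1.2).trans_lt ?_
    have h3 : ‖h‖ * C < ε := (lt_div_iff₀ hCpos).1 h2.2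
    have h4 : (2 * ((2 * M + 1) / r) + 1) / r ≤ C := (le_abs_self _).trans (by linarith)
    calc _ ≤ C * ‖h‖ := by gcongr
      _ < ε := by rwa [mul_comm]
  refine hlim.tendstoLocallyUniformlyOn.differentiableOn ?_ hU
  filter_upwards [hsmall r hr] with h h1
  have hth : t + h ∈ ball t r := by simpa [dist_eq_norm] using h1.2
  exact ((hs _ hth).sub (hs _ (mem_ball_self hr))).const_mul _

theorem differentiableOn_iteratedDeriv_param (n : ℕ) {f : ℂ → ℂ → ℂ} {U : Set ℂ} (hU : IsOpen U)
    {t : ℂ} {r M : ℝ} (hr : 0 < r) (hs : ∀ z ∈ ball t r, DifferentiableOn ℂ (fun s => f s z) U)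
    (ht : ∀ s ∈ U, DifferentiableOn ℂ (f s) (ball t r))
    (hM : ∀ s ∈ U, ∀ z ∈ ball t r, ‖f s z‖ ≤ M) :
    DifferentiableOn ℂ (fun s => iteratedDeriv n (f s) t) U := by
  induction n generalizing f r M with
  | zero => simpa using hs t (mem_ball_self hr)
  | succ n ih =>
    simp_rw [iteratedDeriv_succ']
    have hr2 : 0 < r / 2 := by positivity
    have hsub : ∀ z ∈ ball t (r / 2), closedBall z (r / 2) ⊆ ball t r := fun z hz =>
      closedBall_subset_ball' (by rw [mem_ball] at hz; linarith)
    -- Cauchy's estimate on half the radius keeps the first derivative uniformly bounded, so the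
    -- induction can continue on the smaller disc.
    refine ih (f := fun s => deriv (f s)) (M := M / (r / 2)) hr2 (fun z hz => ?_) (fun s hsU => ?_)
      fun s hsU z hz => ?_
    · have h1 := ball_subset_closedBall.trans (hsub z hz)
      exact differentiableOn_deriv_param hU hr2 (fun y hy => hs y (h1 hy))
        (fun s hsU => (ht s hsU).mono h1) fun s hsU y hy => hM s hsU y (h1 hy)
    · exact ((ht s hsU).deriv isOpen_ball).mono (ball_subset_ball (by linarith))
    · have h1 := hsub z hz
      refine Complex.norm_deriv_le_of_forall_mem_sphere_norm_le hr2
        (((ht s hsU).mono h1).diffContOnCl_ball subset_rfl) fun y hy => ?_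
      exact hM s hsU y (h1 (sphere_subset_closedBall hy))

/-- `g` is holomorphic and bounded by `M` on the bidisc of radius `ϱ`. -/
structure SepHolBounded (ϱ M : ℝ) (g : ℂ → ℂ → ℂ) : Prop where
  diff₀ : ∀ z₁ ∈ ball (0 : ℂ) ϱ, DifferentiableOn ℂ (fun s => g s z₁) (ball 0 ϱ)
  diff₁ : ∀ z₀ ∈ ball (0 : ℂ) ϱ, DifferentiableOn ℂ (g z₀) (ball 0 ϱ)
  bound : ∀ z₀ ∈ ball (0 : ℂ) ϱ, ∀ z₁ ∈ ball (0 : ℂ) ϱ, ‖g z₀ z₁‖ ≤ M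

/-- On the bidisc of radius `R`, the derivatives of `g` satisfy
`|∂₀^{n₀} ∂₁^{n₁} g| ≤ K n₀! n₁! / (r₀^{n₀} r₁^{n₁})`. -/
structure CoefBound (R r₀ r₁ K : ℝ) (g : ℂ → ℂ → ℂ) : Prop where
  diff₁ : ∀ z₀ ∈ ball (0 : ℂ) R, DifferentiableOn ℂ (g z₀) (ball 0 R)
  diff₀ : ∀ n, ∀ z₁ ∈ ball (0 : ℂ) R,
    DifferentiableOn ℂ (fun s => iteratedDeriv n (g s) z₁) (ball 0 R)
  bound : ∀ n₀ n₁, ∀ z₀ ∈ ball (0 : ℂ) R, ∀ z₁ ∈ ball (0 : ℂ) R,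
    ‖iteratedDeriv n₀ (fun s => iteratedDeriv n₁ (g s) z₁) z₀‖ ≤
      K * (n₀ ! / r₀ ^ n₀) * (n₁ ! / r₁ ^ n₁)

theorem CoefBound.const_mul {R r₀ r₁ K : ℝ} {g : ℂ → ℂ → ℂ} (h : CoefBound R r₀ r₁ K g) (k : ℂ) :
    CoefBound R r₀ r₁ (‖k‖ * K) (fun z₀ z₁ => k * g z₀ z₁) where
  diff₁ z₀ hz₀ := (h.diff₁ z₀ hz₀).const_mul k
  diff₀ n z₁ hz₁ := by
    simp_rw [iteratedDeriv_const_mul_field]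
    exact (h.diff₀ n z₁ hz₁).const_mul k
  bound n₀ n₁ z₀ hz₀ z₁ hz₁ := by
    simp_rw [iteratedDeriv_const_mul_field]
    rw [norm_mul, mul_assoc, mul_assoc, ← mul_assoc K]
    exact mul_le_mul_of_nonneg_left (h.bound n₀ n₁ z₀ hz₀ z₁ hz₁) (norm_nonneg k)

theorem SepHolBounded.differentiableOn_iteratedDeriv {ϱ M : ℝ} {g : ℂ → ℂ → ℂ}
    (h : SepHolBounded ϱ M g) (n : ℕ) {z : ℂ} (hz : z ∈ ball (0 : ℂ) ϱ) :
    DifferentiableOn ℂ (fun s => iteratedDeriv n (g s) z) (ball 0 ϱ) := by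
  have hr : 0 < ϱ - dist z 0 := by rw [mem_ball] at hz; linarith
  have hsub : ball z (ϱ - dist z 0) ⊆ ball 0 ϱ := ball_subset_ball' (by linarith)
  exact differentiableOn_iteratedDeriv_param n isOpen_ball hr (fun y hy => h.diff₀ y (hsub hy))
    (fun s hs => (h.diff₁ s hs).mono hsub) fun s hs y hy => h.bound s hs y (hsub hy)

theorem differentiableOn_iteratedDeriv_of_isOpen {f : ℂ → ℂ} {s : Set ℂ} (hs : IsOpen s)
    (hf : DifferentiableOn ℂ f s) (n : ℕ) : DifferentiableOn ℂ (iteratedDeriv n f) s := by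
  induction n with
  | zero => simpa using hf
  | succ n ih => simpa [iteratedDeriv_succ] using ih.deriv hs

theorem iteratedDeriv_iteratedDeriv (n l : ℕ) (f : ℂ → ℂ) :
    iteratedDeriv n (iteratedDeriv l f) = iteratedDeriv (n + l) f := by
  simp only [iteratedDeriv_eq_iterate, Function.iterate_add_apply]

/-- A single term of the binomial expansion of `(r₁ + c)^(n + l)` is at most `r^(n + l)`. Splitting
the radius in this way separates the factor due to `l` from the one due to `n`. -/
theorem factorial_add_div_le {n l : ℕ} {r₁ c r : ℝ} (h₁ : 0 < r₁) (hc : 0 < c) (h : r₁ + c ≤ r) :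
    ((n + l)! : ℝ) / r ^ (n + l) ≤ (l ! : ℝ) / c ^ l * (n ! / r₁ ^ n) := by
  have hr : 0 < r := by linarith
  have h2 : r₁ ^ n * c ^ l * ((n + l).choose n : ℝ) ≤ r ^ (n + l) := by
    refine le_trans ?_ (pow_le_pow_left₀ (by positivity) h (n + l))
    rw [add_pow]
    have := Finset.single_le_sum (f := fun m => r₁ ^ m * c ^ (n + l - m) * ((n + l).choose m : ℝ))
      (fun m _ => by positivity) (Finset.mem_range.2 (by omega : n < n + l + 1))
    simpa using this
  have h3 : ((n + l)! : ℝ) = (n + l).choose n * n ! * l ! := by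
    have := Nat.add_choose_mul_factorial_mul_factorial n l
    rw [← Nat.choose_symm_add] at this
    exact_mod_cast this.symm
  rw [div_mul_div_comm, div_le_div_iff₀ (by positivity) (by positivity), h3]
  calc _ = (r₁ ^ n * c ^ l * ((n + l).choose n : ℝ)) * (n ! * l !) := by ring
    _ ≤ r ^ (n + l) * (n ! * l !) := by gcongr
    _ = _ := by ring

/-- Cauchy's estimate of order `n₁ + l` in the second variable, then of order `n₀` in the first,
both on circles of radius `r`. The `l` derivatives already taken are paid for by shrinking the
second radius from `r` to `r₁`. -/
theorem SepHolBounded.coefBound {ϱ M R r r₁ c : ℝ} {g : ℂ → ℂ → ℂ} (h : SepHolBounded ϱ M g)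
    (hM : 0 ≤ M) (hr : 0 < r) (hR : R + r < ϱ) (h₁ : 0 < r₁) (hc : 0 < c) (hrc : r₁ + c ≤ r)
    (l : ℕ) :
    CoefBound R r r₁ (M * (l ! / c ^ l)) (fun z₀ z₁ => iteratedDeriv l (g z₀) z₁) := by
  have hsub : ball (0 : ℂ) R ⊆ ball 0 ϱ := ball_subset_ball (by linarith)
  have hcl : ∀ z ∈ ball (0 : ℂ) R, closedBall z r ⊆ ball (0 : ℂ) ϱ := fun z hz =>
    closedBall_subset_ball' (by rw [mem_ball] at hz; linarith)
  refine ⟨fun z₀ hz₀ => ?_, fun n z₁ hz₁ => ?_, fun n₀ n₁ z₀ hz₀ z₁ hz₁ => ?_⟩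
  · refine DifferentiableOn.mono ?_ hsub
    exact differentiableOn_iteratedDeriv_of_isOpen isOpen_ball (h.diff₁ z₀ (hsub hz₀)) l
  · change DifferentiableOn ℂ (fun s => iteratedDeriv n (iteratedDeriv l (g s)) z₁) _
    simp_rw [iteratedDeriv_iteratedDeriv]
    exact (h.differentiableOn_iteratedDeriv (n + l) (hsub hz₁)).mono hsub
  · change ‖iteratedDeriv n₀ (fun s => iteratedDeriv n₁ (iteratedDeriv l (g s)) z₁) z₀‖ ≤ _
    simp_rw [iteratedDeriv_iteratedDeriv]
    have h2 : ∀ s ∈ ball (0 : ℂ) ϱ,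
        ‖iteratedDeriv (n₁ + l) (g s) z₁‖ ≤ (n₁ + l)! * M / r ^ (n₁ + l) := fun s hs =>
      Complex.norm_iteratedDeriv_le_of_forall_mem_sphere_norm_le _ hr
        (((h.diff₁ s hs).mono (hcl z₁ hz₁)).diffContOnCl_ball subset_rfl)
        fun y hy => h.bound s hs y (hcl z₁ hz₁ (sphere_subset_closedBall hy))
    have h3 := Complex.norm_iteratedDeriv_le_of_forall_mem_sphere_norm_le n₀ hr
      (((h.differentiableOn_iteratedDeriv (n₁ + l) (hsub hz₁)).mono
        (hcl z₀ hz₀)).diffContOnCl_ball subset_rfl)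
      fun y hy => h2 y (hcl z₀ hz₀ (sphere_subset_closedBall hy))
    refine h3.trans ?_
    calc _ = M * (n₀ ! / r ^ n₀) * ((n₁ + l)! / r ^ (n₁ + l)) := by ring
      _ ≤ M * (n₀ ! / r ^ n₀) * ((l ! : ℝ) / c ^ l * (n₁ ! / r₁ ^ n₁)) := by
        gcongr
        exact factorial_add_div_le h₁ hc hrc
      _ = _ := by ring

open Polynomial

/-! ### Mixed derivatives of functions polynomial in the `u_h` -/

/-- Points with `|v₀| < R` and `|v₁| < R`. -/
def vBidisc (R : ℝ) : Set (Var → ℂ) := {x | ∀ i, ‖x (V i)‖ < R}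

/-- On `|v₀|, |v₁| < R`, the function `F` is the sum over `i ∈ s` of
`g_i(v₀, v₁) ∏_{h ∈ T} P_{i,h}(u_h)`. -/
def IsSumOfProducts {ι : Type*} (R : ℝ) (s : Finset ι) (T : Finset ℕ) (g : ι → ℂ → ℂ → ℂ)
    (P : ι → ℕ → ℂ[X]) (F : (Var → ℂ) → ℂ) : Prop :=
  ∀ x ∈ vBidisc R, F x = ∑ i ∈ s, g i (x (V 0)) (x (V 1)) * ∏ h ∈ T, (P i h).eval (x (U h))

theorem iteratedDeriv_eval (P : ℂ[X]) (n : ℕ) :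
    iteratedDeriv n (fun z => P.eval z) = fun z => (derivative^[n] P).eval z := by
  induction n with
  | zero => simp
  | succ n ih =>
    rw [iteratedDeriv_succ, ih, Function.iterate_succ_apply']
    ext z
    exact Polynomial.deriv _

theorem update_U_mem_vBidisc {R : ℝ} {x : Var → ℂ} (hx : x ∈ vBidisc R) (k : ℕ) (z : ℂ) :
    Function.update x (U k) z ∈ vBidisc R := by
  intro i
  rw [Function.update_of_ne (by simp)]
  exact hx i

theorem update_V_mem_vBidisc {R : ℝ} {x : Var → ℂ} (hx : x ∈ vBidisc R) (k : Fin 2) {z : ℂ}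
    (hz : ‖z‖ < R) : Function.update x (V k) z ∈ vBidisc R := by
  intro i
  by_cases h : i = k
  · subst h; simpa using hz
  · rw [Function.update_of_ne (by simpa using h)]
    exact hx i

section mixed

variable {ι : Type*} {R : ℝ} {s : Finset ι} {T : Finset ℕ} {g : ι → ℂ → ℂ → ℂ}
  {P : ι → ℕ → ℂ[X]} {F : (Var → ℂ) → ℂ}

theorem IsSumOfProducts.partialDeriv_U (hF : IsSumOfProducts R s T g P F) {k : ℕ} (hk : k ∈ T)
    (n : ℕ) :
    IsSumOfProducts R s T g (fun i h => if h = k then derivative^[n] (P i h) else P i h)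
      (partialDeriv (U k) n F) := by
  intro x hx
  have h1 : (fun z : ℂ => F (Function.update x (U k) z)) = fun z => ∑ i ∈ s,
      (g i (x (V 0)) (x (V 1)) * ∏ h ∈ T.erase k, (P i h).eval (x (U h))) * (P i k).eval z := by
    ext z
    rw [hF _ (update_U_mem_vBidisc hx k z)]
    refine Finset.sum_congr rfl fun i _ => ?_
    rw [← Finset.prod_erase_mul _ _ hk, ← mul_assoc, Function.update_self,
      Function.update_of_ne (by simp), Function.update_of_ne (by simp)]
    congr 2
    refine Finset.prod_congr rfl fun h hh => ?_
    rw [Function.update_of_ne (by simpa using Finset.ne_of_mem_erase hh)]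
  rw [partialDeriv, h1, iteratedDeriv_fun_sum fun i _ =>
    contDiffAt_const.mul (P i k).differentiable.contDiff.contDiffAt]
  refine Finset.sum_congr rfl fun i _ => ?_
  rw [iteratedDeriv_const_mul_field, iteratedDeriv_eval, ← Finset.prod_erase_mul _ _ hk]
  simp only [if_true, mul_assoc]
  congr 2
  refine Finset.prod_congr rfl fun h hh => ?_
  rw [if_neg (Finset.ne_of_mem_erase hh)]

theorem IsSumOfProducts.foldr_partialDeriv (hF : IsSumOfProducts R s T g P F) (m : MultiIndex)
    {l : List ℕ} (hl : l.Nodup) (hlT : ∀ h ∈ l, h ∈ T) :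
    IsSumOfProducts R s T g (fun i h => if h ∈ l then derivative^[m (U h)] (P i h) else P i h)
      (l.foldr (fun h G => partialDeriv (U h) (m (U h)) G) F) := by
  induction l with
  | nil => simpa using hF
  | cons k l ih =>
    rw [List.nodup_cons] at hl
    have := (ih hl.2 fun h hh => hlT h (List.mem_cons_of_mem k hh)).partialDeriv_U
      (hlT k List.mem_cons_self) (m (U k))
    rw [List.foldr_cons]
    convert this using 3 with i h
    by_cases hhk : h = k
    · subst hhk
      simp [hl.1]
    · simp [hhk]

theorem IsSumOfProducts.mixedDeriv_eq {r₀ r₁ : ℝ} {K : ι → ℝ} {N : ℕ}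
    (hF : IsSumOfProducts R s (Finset.range (N + 1)) g P F)
    (hg : ∀ i ∈ s, CoefBound R r₀ r₁ (K i) (g i)) (m : MultiIndex) {x : Var → ℂ}
    (hx : x ∈ vBidisc R) :
    mixedDeriv N m F x = ∑ i ∈ s,
      iteratedDeriv (m (V 0)) (fun z => iteratedDeriv (m (V 1)) (g i z) (x (V 1))) (x (V 0)) *
        ∏ h ∈ Finset.range (N + 1), (derivative^[m (U h)] (P i h)).eval (x (U h)) := by
  set G := (List.range (N + 1)).foldr (fun h G => partialDeriv (U h) (m (U h)) G) F with hG
  set Q : ι → (Var → ℂ) → ℂ := fun i x =>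
    ∏ h ∈ Finset.range (N + 1), (derivative^[m (U h)] (P i h)).eval (x (U h)) with hQ
  have hGx : ∀ x ∈ vBidisc R, G x = ∑ i ∈ s, g i (x (V 0)) (x (V 1)) * Q i x := by
    intro x hx
    rw [hG, hF.foldr_partialDeriv m List.nodup_range (by simp) x hx]
    refine Finset.sum_congr rfl fun i _ => ?_
    congr 1
    refine Finset.prod_congr rfl fun h hh => ?_
    simp only [if_pos (show h ∈ List.range (N + 1) by simpa using hh)]
  have hQu : ∀ i x j z, Q i (Function.update x (V j) z) = Q i x := fun i x j z =>
    Finset.prod_congr rfl fun h _ => by rw [Function.update_of_ne (by simp)]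
  have hV : ∀ x ∈ vBidisc R, partialDeriv (V 1) (m (V 1)) G x =
      ∑ i ∈ s, iteratedDeriv (m (V 1)) (g i (x (V 0))) (x (V 1)) * Q i x := by
    intro x hx
    -- The product formula holds only over the bidisc; this set is open in `v₁`, so the two
    -- functions have the same germ and the same derivatives.
    have hev : (fun z : ℂ => G (Function.update x (V 1) z)) =ᶠ[nhds (x (V 1))]
        fun z => ∑ i ∈ s, g i (x (V 0)) z * Q i x := by
      filter_upwards [isOpen_ball.mem_nhds (mem_ball_zero_iff.2 (hx 1))] with z hz
      rw [hGx _ (update_V_mem_vBidisc hx 1 (mem_ball_zero_iff.1 hz))]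
      refine Finset.sum_congr rfl fun i _ => ?_
      rw [hQu, Function.update_self, Function.update_of_ne (by simp)]
    rw [partialDeriv, hev.iteratedDeriv_eq, iteratedDeriv_fun_sum]
    · exact Finset.sum_congr rfl fun i _ => by rw [iteratedDeriv_mul_const_field]
    · intro i hi
      have h1 := (hg i hi).diff₁ (x (V 0)) (mem_ball_zero_iff.2 (hx 0))
      exact ((h1.contDiffOn isOpen_ball).contDiffAt
        (isOpen_ball.mem_nhds (mem_ball_zero_iff.2 (hx 1)))).mul contDiffAt_const
  have hev : (fun z : ℂ => partialDeriv (V 1) (m (V 1)) G (Function.update x (V 0) z))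
      =ᶠ[nhds (x (V 0))]
      fun z => ∑ i ∈ s, iteratedDeriv (m (V 1)) (g i z) (x (V 1)) * Q i x := by
    filter_upwards [isOpen_ball.mem_nhds (mem_ball_zero_iff.2 (hx 0))] with z hz
    rw [hV _ (update_V_mem_vBidisc hx 0 (mem_ball_zero_iff.1 hz))]
    refine Finset.sum_congr rfl fun i _ => ?_
    rw [hQu, Function.update_self, Function.update_of_ne (by simp)]
  rw [mixedDeriv, ← hG, partialDeriv, hev.iteratedDeriv_eq, iteratedDeriv_fun_sum]
  · exact Finset.sum_congr rfl fun i _ => by rw [iteratedDeriv_mul_const_field]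
  · intro i hi
    have h1 := (hg i hi).diff₀ (m (V 1)) (x (V 1)) (mem_ball_zero_iff.2 (hx 1))
    exact ((h1.contDiffOn isOpen_ball).contDiffAt
      (isOpen_ball.mem_nhds (mem_ball_zero_iff.2 (hx 0)))).mul contDiffAt_const

end mixed

/-! ### The weighted norm of a majorant series -/

theorem norm_eval_iterate_derivative_X_pow_le {ρ : ℝ} {u : ℂ} (hu : ‖u‖ ≤ ρ) (e n : ℕ) :
    ‖(derivative^[n] (X ^ e : ℂ[X])).eval u‖ ≤ n ! * (e.choose n * ρ ^ (e - n)) := by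
  rw [iterate_derivative_X_pow_eq_smul, eval_smul, eval_pow, eval_X, smul_eq_mul, norm_mul, norm_pow,
    Complex.norm_natCast, Nat.descFactorial_eq_factorial_mul_choose, Nat.cast_mul, mul_assoc]
  gcongr

/-- The indices of `V₀`, `V₁`, `U_0, …, U_N`. -/
def varsUpTo (N : ℕ) : Finset Var := Finset.disjSum Finset.univ (Finset.range (N + 1))

theorem Supported.support_subset {N : ℕ} {m : MultiIndex} (h : Supported N m) :
    m.support ⊆ varsUpTo N := by
  rintro (i | k) hv
  · simp [varsUpTo]
  · have := h k (by simpa using hv)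
    simp only [varsUpTo, Finset.inr_mem_disjSum, Finset.mem_range]
    omega

theorem prod_varsUpTo {M : Type*} [CommMonoid M] (N : ℕ) (f : Var → M) :
    ∏ v ∈ varsUpTo N, f v = f (V 0) * f (V 1) * ∏ h ∈ Finset.range (N + 1), f (U h) := by
  rw [varsUpTo, Finset.prod_disjSum, Fin.prod_univ_two]

/-- A finite set of multi-indices supported in `S` embeds into a box `{0, …, M - 1}^S`, over which
the sum of products is a product of sums. -/
theorem tsum_prod_le_prod_tsum {κ : Type*} (S : Finset κ) (f : κ → ℕ → ℝ≥0∞)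
    (a : (κ →₀ ℕ) → ℝ≥0∞) (ha : ∀ m, m.support ⊆ S → a m ≤ ∏ i ∈ S, f i (m i))
    (ha' : ∀ m, ¬ m.support ⊆ S → a m = 0) :
    ∑' m, a m ≤ ∏ i ∈ S, ∑' n, f i n := by
  classical
  refine ENNReal.summable.tsum_le_of_sum_le fun T => ?_
  set T' := T.filter fun m => m.support ⊆ S with hT'
  obtain ⟨M, hM⟩ : ∃ M, ∀ m ∈ T', ∀ i ∈ S, m i < M := by
    refine ⟨(T'.sup fun m => S.sup fun i => m i) + 1, fun m hm i hi => Nat.lt_succ_of_le ?_⟩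
    exact (Finset.le_sup (f := fun i => m i) hi).trans
      (Finset.le_sup (f := fun m : κ →₀ ℕ => S.sup fun i => m i) hm)
  set res : (κ →₀ ℕ) → (∀ i ∈ S, ℕ) := fun m i _ => m i with hres
  have hinj : Set.InjOn res T' := by
    intro m hm m' hm' h
    have hm := (Finset.mem_filter.1 hm).2
    have hm' := (Finset.mem_filter.1 hm').2
    ext i
    by_cases hi : i ∈ S
    · exact congr_fun (congr_fun h i) hi
    · rw [Finsupp.notMem_support_iff.1 fun h => hi (hm h),
        Finsupp.notMem_support_iff.1 fun h => hi (hm' h)]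
  calc ∑ m ∈ T, a m = ∑ m ∈ T', a m := by
        refine (Finset.sum_subset (Finset.filter_subset _ _) fun m hm hm' => ha' m fun h => ?_).symm
        exact hm' (Finset.mem_filter.2 ⟨hm, h⟩)
    _ ≤ ∑ m ∈ T', ∏ x ∈ S.attach, f x (res m x x.2) := by
        refine Finset.sum_le_sum fun m hm => (ha m (Finset.mem_filter.1 hm).2).trans (le_of_eq ?_)
        rw [← Finset.prod_attach]
    _ = ∑ p ∈ T'.image res, ∏ x ∈ S.attach, f x (p x x.2) := by rw [Finset.sum_image hinj]
    _ ≤ ∑ p ∈ S.pi fun _ => Finset.range M, ∏ x ∈ S.attach, f x (p x x.2) := by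
        refine Finset.sum_le_sum_of_subset fun p hp => ?_
        obtain ⟨m, hm, rfl⟩ := Finset.mem_image.1 hp
        exact Finset.mem_pi.2 fun i hi => Finset.mem_range.2 (hM m hm i hi)
    _ = ∏ i ∈ S, ∑ n ∈ Finset.range M, f i n := (Finset.prod_sum _ _ _).symm
    _ ≤ _ := Finset.prod_le_prod' fun i _ => ENNReal.sum_le_tsum _

theorem tsum_ofReal_binomial {ρ t : ℝ} (hρ : 0 ≤ ρ) (ht : 0 ≤ t) (e : ℕ) :
    ∑' n : ℕ, ENNReal.ofReal (e.choose n * ρ ^ (e - n) * t ^ n) = ENNReal.ofReal ((ρ + t) ^ e) := by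
  rw [tsum_eq_sum (s := Finset.range (e + 1))]
  · rw [← ENNReal.ofReal_sum_of_nonneg fun n _ => by positivity, add_comm ρ t, add_pow]
    congr 1
    exact Finset.sum_congr rfl fun n _ => by ring
  · intro n hn
    rw [Nat.choose_eq_zero_of_lt (by simpa using hn)]
    simp

section majorant

variable {ι : Type*} {R : ℝ} {s : Finset ι} {g : ι → ℂ → ℂ → ℂ} {F : (Var → ℂ) → ℂ}

/-- Each derivative of each product splits over the variables, and so does its supremum bound. In
`v₀`, `v₁` the factorials cancel and leave geometric series. In `u_h` they leave the binomial
expansion of `(ρ + w_h)^{e_h}`, at most `((1 + δ)ρ)^{e_h}`; only the total degree `D` enters, not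
`N`. -/
theorem IsSumOfProducts.l1Norm_majorant_le {r₀ r₁ ρ δ : ℝ} {K : ι → ℝ} {N D : ℕ} {w : Var → ℝ}
    {e : ι → ℕ → ℕ}
    (hF : IsSumOfProducts R s (Finset.range (N + 1)) g (fun i h => X ^ e i h) F)
    (hg : ∀ i ∈ s, CoefBound R r₀ r₁ (K i) (g i)) (hK : ∀ i ∈ s, 0 ≤ K i)
    (hw : ∀ i, 0 < w i) (hw₀ : w (V 0) < r₀) (hw₁ : w (V 1) < r₁) (hwU : ∀ h, w (U h) ≤ δ)
    (hρ : 1 ≤ ρ) (he : ∀ i ∈ s, ∑ h ∈ Finset.range (N + 1), e i h ≤ D) :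
    l1Norm w (majorant R ρ N F) ≤ ENNReal.ofReal ((1 - w (V 0) / r₀)⁻¹ * (1 - w (V 1) / r₁)⁻¹ *
      ((∑ i ∈ s, K i) * ((1 + δ) * ρ) ^ D)) := by
  have hr₀ : 0 < r₀ := (hw _).trans hw₀
  have hr₁ : 0 < r₁ := (hw _).trans hw₁
  have hδ : 0 < δ := (hw (U 0)).trans_le (hwU 0)
  set f : ι → Var → ℕ → ℝ := fun i v n => Sum.elim
    (fun j => (w (V j) / (if j = 0 then r₀ else r₁)) ^ n)
    (fun h => (e i h).choose n * ρ ^ (e i h - n) * w (U h) ^ n) v with hf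
  have hf0 : ∀ i v n, 0 ≤ f i v n := by
    rintro i (j | h) n
    · have := hw (V j)
      simp only [hf, Sum.elim_inl]
      split_ifs <;> positivity
    · have := hw (U h)
      simp only [hf, Sum.elim_inr]
      positivity
  have hcoef : ∀ m : MultiIndex, m.support ⊆ varsUpTo N →
      ‖MvPowerSeries.coeff m (majorant R ρ N F)‖ * monomialWeight w m ≤
        ∑ i ∈ s, K i * ∏ v ∈ varsUpTo N, f i v (m v) := by
    intro m hm
    have hsup : supDeriv R ρ N F m ≤ ∑ i ∈ s, K i * ((m (V 0))! / r₀ ^ m (V 0)) *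
        ((m (V 1))! / r₁ ^ m (V 1)) * ∏ h ∈ Finset.range (N + 1),
          ((m (U h))! * ((e i h).choose (m (U h)) * ρ ^ (e i h - m (U h)))) := by
      -- The upper bound must also be nonnegative because the supremum of an empty set of reals is
      -- `0`.
      refine Real.sSup_le ?_ (Finset.sum_nonneg fun i hi => ?_)
      · rintro _ ⟨x, hx, rfl⟩
        have hxV : x ∈ vBidisc R := hx.1
        simp only
        rw [hF.mixedDeriv_eq hg m hxV]
        refine (norm_sum_le _ _).trans (Finset.sum_le_sum fun i hi => ?_)
        rw [norm_mul, norm_prod]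
        have h1 := (hg i hi).bound (m (V 0)) (m (V 1)) (x (V 0)) (mem_ball_zero_iff.2 (hx.1 0))
          (x (V 1)) (mem_ball_zero_iff.2 (hx.1 1))
        refine mul_le_mul h1 ?_ (by positivity) ((norm_nonneg _).trans h1)
        exact Finset.prod_le_prod (fun _ _ => norm_nonneg _) fun h _ =>
          norm_eval_iterate_derivative_X_pow_le (hx.2 h).le _ _
      · have := hK i hi
        positivity
    have hsup0 : 0 ≤ supDeriv R ρ N F m := Real.sSup_nonneg (by
      rintro _ ⟨x, _, rfl⟩
      exact norm_nonneg _)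
    have hnorm : ‖MvPowerSeries.coeff m (majorant R ρ N F)‖ ≤
        supDeriv R ρ N F m / multiFactorial m := by
      change ‖majorant R ρ N F m‖ ≤ _
      rw [majorant]
      split_ifs
      · rw [Complex.norm_real, Real.norm_of_nonneg (by positivity)]
      · rw [norm_zero]; positivity
    have hfac : (multiFactorial m : ℝ) = (m (V 0))! * (m (V 1))! *
        ∏ h ∈ Finset.range (N + 1), ((m (U h))! : ℝ) := by
      rw [multiFactorial, Finsupp.prod_of_support_subset _ hm _ (by simp), prod_varsUpTo]
      push_cast
      rfl
    have hmon : monomialWeight w m = w (V 0) ^ m (V 0) * w (V 1) ^ m (V 1) *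
        ∏ h ∈ Finset.range (N + 1), w (U h) ^ m (U h) := by
      rw [monomialWeight, Finsupp.prod_of_support_subset _ hm _ (by simp), prod_varsUpTo]
    have hmpos := monomialWeight_pos hw m
    have hfpos : (0 : ℝ) < multiFactorial m := by exact_mod_cast multiFactorial_pos m
    calc _ ≤ (∑ i ∈ s, K i * ((m (V 0))! / r₀ ^ m (V 0)) *
          ((m (V 1))! / r₁ ^ m (V 1)) * ∏ h ∈ Finset.range (N + 1),
          ((m (U h))! * ((e i h).choose (m (U h)) * ρ ^ (e i h - m (U h))))) /
            multiFactorial m * monomialWeight w m := by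
          refine mul_le_mul_of_nonneg_right (hnorm.trans ?_) hmpos.le
          exact div_le_div_of_nonneg_right hsup hfpos.le
      _ = _ := by
          rw [Finset.sum_div, Finset.sum_mul]
          refine Finset.sum_congr rfl fun i _ => ?_
          rw [div_mul_eq_mul_div, div_eq_iff hfpos.ne', hmon, hfac, prod_varsUpTo]
          simp only [hf, Sum.elim_inl, Sum.elim_inr, Finset.prod_mul_distrib, if_pos,
            one_ne_zero, if_false, div_pow]
          field_simp
  have hL : l1Norm w (majorant R ρ N F) ≤
      ∑ i ∈ s, ENNReal.ofReal (K i) * ∏ v ∈ varsUpTo N, ∑' n, ENNReal.ofReal (f i v n) := by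
    have h1 : l1Norm w (majorant R ρ N F) ≤ ∑' m : MultiIndex, ∑ i ∈ s, ENNReal.ofReal (K i) *
        (if m.support ⊆ varsUpTo N then
          ∏ v ∈ varsUpTo N, ENNReal.ofReal (f i v (m v)) else 0) := by
      refine ENNReal.tsum_le_tsum fun m => ?_
      by_cases hm : m.support ⊆ varsUpTo N
      · refine (ENNReal.ofReal_le_ofReal (hcoef m hm)).trans (le_of_eq ?_)
        rw [ENNReal.ofReal_sum_of_nonneg fun i hi => mul_nonneg (hK i hi)
          (Finset.prod_nonneg fun v _ => hf0 _ _ _)]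
        refine Finset.sum_congr rfl fun i hi => ?_
        rw [if_pos hm, ENNReal.ofReal_mul (hK i hi),
          ENNReal.ofReal_prod_of_nonneg fun v _ => hf0 _ _ _]
      · have h0 : MvPowerSeries.coeff m (majorant R ρ N F) = 0 := by
          by_contra h
          exact hm (SupportedSeries.majorant R ρ N F m h).support_subset
        simp [h0]
    refine h1.trans ?_
    rw [Summable.tsum_finsetSum fun i _ => ENNReal.summable]
    refine Finset.sum_le_sum fun i _ => ?_
    rw [ENNReal.tsum_mul_left]
    exact mul_le_mul_right (tsum_prod_le_prod_tsum _ (fun v n => ENNReal.ofReal (f i v n)) _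
      (fun m hm => by rw [if_pos hm]) fun m hm => by rw [if_neg hm]) _
  have hq₀ : w (V 0) / r₀ < 1 := (div_lt_one hr₀).2 hw₀
  have hq₁ : w (V 1) / r₁ < 1 := (div_lt_one hr₁).2 hw₁
  have hp₀ : 0 ≤ w (V 0) / r₀ := div_nonneg (hw _).le hr₀.le
  have hp₁ : 0 ≤ w (V 1) / r₁ := div_nonneg (hw _).le hr₁.le
  have hi₀ : 0 ≤ (1 - w (V 0) / r₀)⁻¹ := inv_nonneg.2 (by linarith)
  have hi₁ : 0 ≤ (1 - w (V 1) / r₁)⁻¹ := inv_nonneg.2 (by linarith)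
  have hprod : ∀ i ∈ s, ∏ v ∈ varsUpTo N, ∑' n, ENNReal.ofReal (f i v n) ≤
      ENNReal.ofReal ((1 - w (V 0) / r₀)⁻¹ * (1 - w (V 1) / r₁)⁻¹ * ((1 + δ) * ρ) ^ D) := by
    intro i hi
    rw [prod_varsUpTo]
    simp only [hf, Sum.elim_inl, Sum.elim_inr, if_pos, one_ne_zero, if_false]
    rw [tsum_ofReal_geometric hp₀ hq₀, tsum_ofReal_geometric hp₁ hq₁,
      ENNReal.ofReal_mul (mul_nonneg hi₀ hi₁), ENNReal.ofReal_mul hi₀]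
    gcongr
    calc _ = ENNReal.ofReal (∏ h ∈ Finset.range (N + 1), (ρ + w (U h)) ^ e i h) := by
          rw [ENNReal.ofReal_prod_of_nonneg fun h _ => by have := hw (U h); positivity]
          exact Finset.prod_congr rfl fun h _ =>
            tsum_ofReal_binomial (by linarith) (hw _).le _
      _ ≤ _ := ENNReal.ofReal_le_ofReal ?_
    have h1 : 1 ≤ (1 + δ) * ρ := by nlinarith
    calc _ ≤ ∏ h ∈ Finset.range (N + 1), ((1 + δ) * ρ) ^ e i h := by
          refine Finset.prod_le_prod (fun h _ => by have := hw (U h); positivity) fun h _ => ?_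
          have := hw (U h)
          have h2 := hwU h
          refine pow_le_pow_left₀ (by positivity) ?_ _
          nlinarith
      _ = ((1 + δ) * ρ) ^ ∑ h ∈ Finset.range (N + 1), e i h := Finset.prod_pow_eq_pow_sum _ _ _
      _ ≤ _ := pow_le_pow_right₀ h1 (he i hi)
  refine hL.trans ?_
  calc _ ≤ ∑ i ∈ s, ENNReal.ofReal (K i) * ENNReal.ofReal
        ((1 - w (V 0) / r₀)⁻¹ * (1 - w (V 1) / r₁)⁻¹ * ((1 + δ) * ρ) ^ D) :=
        Finset.sum_le_sum fun i hi => mul_le_mul_right (hprod i hi) _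
    _ = _ := by
        rw [← Finset.sum_mul, ← ENNReal.ofReal_sum_of_nonneg hK,
          ← ENNReal.ofReal_mul (Finset.sum_nonneg hK)]
        congr 1
        ring

end majorant

/-! ### The functions `A_j` and `B_j` -/

theorem CoefBound.mono {R r₀ r₁ K K' : ℝ} {g : ℂ → ℂ → ℂ} (h : CoefBound R r₀ r₁ K g)
    (hr₀ : 0 < r₀) (hr₁ : 0 < r₁) (hK : K ≤ K') : CoefBound R r₀ r₁ K' g :=
  ⟨h.diff₁, h.diff₀, fun n₀ n₁ z₀ hz₀ z₁ hz₁ =>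
    (h.bound n₀ n₁ z₀ hz₀ z₁ hz₁).trans (by gcongr)⟩

theorem exists_sepHolBounded {R' ϱ : ℝ} (hϱ : ϱ < R') {f : ℂ × ℂ → ℂ}
    (hf : DifferentiableOn ℂ f (ball 0 R' ×ˢ ball 0 R')) :
    ∃ M, 0 ≤ M ∧ SepHolBounded ϱ M fun z₀ z₁ => f (z₀, z₁) := by
  have hsub : ball (0 : ℂ) ϱ ⊆ ball 0 R' := ball_subset_ball hϱ.le
  have hK : IsCompact (closedBall (0 : ℂ) ϱ ×ˢ closedBall (0 : ℂ) ϱ) :=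
    (isCompact_closedBall _ _).prod (isCompact_closedBall _ _)
  obtain ⟨M, hM⟩ := hK.exists_bound_of_continuousOn (hf.continuousOn.mono
    (Set.prod_mono (closedBall_subset_ball hϱ) (closedBall_subset_ball hϱ)))
  refine ⟨max M 0, le_max_right _ _, fun z₁ hz₁ => ?_, fun z₀ hz₀ => ?_, fun z₀ hz₀ z₁ hz₁ => ?_⟩
  · exact hf.comp (f := fun s => (s, z₁)) (by fun_prop) fun s hs => ⟨hsub hs, hsub hz₁⟩
  · exact hf.comp (f := fun s => (z₀, s)) (by fun_prop) fun s hs => ⟨hsub hz₀, hsub hs⟩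
  · exact (hM _ ⟨ball_subset_closedBall hz₀, ball_subset_closedBall hz₁⟩).trans (le_max_left _ _)

/-- With the radius loss `c = 1 / ν` the cost `l! / c^l` of the `l` derivatives is exactly `l! ν^l`,
the denominator of `scaledDeriv`. Hence a bound independent of `l`. -/
theorem coefBound_scaledDeriv {ϱ M R r r₁ ν : ℝ} {f : ℂ × ℂ → ℂ}
    (h : SepHolBounded ϱ M fun z₀ z₁ => f (z₀, z₁)) (hM : 0 ≤ M) (hr : 0 < r) (hR : R + r < ϱ)
    (h₁ : 0 < r₁) (hν : 0 < ν) (hrc : r₁ + 1 / ν ≤ r) (l : ℕ) :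
    CoefBound R r r₁ M (scaledDeriv ν f l) := by
  have h2 := (h.coefBound hM hr hR h₁ (by positivity : 0 < 1 / ν) hrc l).const_mul
    (((l ! : ℂ) * (ν : ℂ) ^ l)⁻¹)
  have h3 : ‖((l ! : ℂ) * (ν : ℂ) ^ l)⁻¹‖ = ((l ! : ℝ) * ν ^ l)⁻¹ := by
    rw [norm_inv, norm_mul, norm_pow, Complex.norm_natCast, Complex.norm_real,
      Real.norm_of_nonneg hν.le]
  have h4 : ((l ! : ℝ) * ν ^ l)⁻¹ * (M * (l ! / (1 / ν) ^ l)) = M := by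
    rw [one_div, inv_pow]
    field_simp
  rw [h3, h4] at h2
  convert h2 using 1
  ext z₀ z₁
  rw [scaledDeriv, div_eq_inv_mul]

/-- The first entry is determined by the other `p`, each of which is at most `j`. -/
theorem card_antidiagonalTuple_le (p j : ℕ) :
    (Finset.Nat.antidiagonalTuple (p + 1) j).card ≤ (j + 1) ^ p := by
  have h : (Fintype.piFinset fun _ : Fin p => Finset.range (j + 1)).card = (j + 1) ^ p := by simp
  rw [← h]
  refine Finset.card_le_card_of_injOn (fun c t => c t.succ) (fun c hc => ?_) fun c hc c' hc' h => ?_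
  · have hc := Finset.Nat.mem_antidiagonalTuple.1 hc
    refine Fintype.mem_piFinset.2 fun t => Finset.mem_range.2 (Nat.lt_succ_of_le ?_)
    rw [← hc]
    exact Finset.single_le_sum (fun _ _ => Nat.zero_le _) (Finset.mem_univ t.succ)
  · have hc := Finset.Nat.mem_antidiagonalTuple.1 hc
    have hc' := Finset.Nat.mem_antidiagonalTuple.1 hc'
    have ht : ∀ t : Fin p, c t.succ = c' t.succ := fun t => congr_fun h t
    rw [Fin.sum_univ_succ] at hc hc'
    simp_rw [ht] at hc
    ext t
    refine Fin.cases ?_ ht t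
    omega

/-- The exponents: the first sum has `j + 1` terms of size `O(j + 1)`, the second at most `(j +
1)^p` tuples for each `p ≤ d`, hence `max 2 d`. The degree in the `u_h` is `1` in the first sum and
`p ≤ d` in the second, hence `max 1 d`. -/
theorem l1Norm_majorant_funA_le {R r₀ r₁ ν ρ δ M : ℝ} {d j N : ℕ} {a : ℂ × ℂ → ℂ}
    {ap : ℕ → ℂ × ℂ → ℂ} {w : Var → ℝ} (hν : 0 < ν) (hM : 0 ≤ M)
    (ha : ∀ l, CoefBound R r₀ r₁ M (scaledDeriv ν a l))
    (hap : ∀ p ≤ d, ∀ l, CoefBound R r₀ r₁ M (scaledDeriv ν (ap p) l))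
    (hw : ∀ i, 0 < w i) (hw₀ : w (V 0) < r₀) (hw₁ : w (V 1) < r₁) (hwU : ∀ h, w (U h) ≤ δ)
    (hρ : 1 ≤ ρ) (hj : j + 1 ≤ N) :
    l1Norm w (majorant R ρ N (funA ν d a ap j)) ≤
      ENNReal.ofReal ((1 - w (V 0) / r₀)⁻¹ * (1 - w (V 1) / r₁)⁻¹ *
        (M * (ν + (d + 1)) * (1 + δ) ^ max 1 d) * ((j : ℝ) + 1) ^ max 2 d * ρ ^ max 1 d) := by
  have hr₀ : 0 < r₀ := (hw _).trans hw₀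
  have hr₁ : 0 < r₁ := (hw _).trans hw₁
  have hδ : 0 < δ := (hw (U 0)).trans_le (hwU 0)
  set s : Finset ((ℕ × ℕ) ⊕ (Σ p : ℕ, Fin (p + 1) → ℕ)) := (antidiagonal j).disjSum
    ((Finset.range (d + 1)).sigma fun p => Finset.Nat.antidiagonalTuple (p + 1) j) with hs
  set g : (ℕ × ℕ) ⊕ (Σ p : ℕ, Fin (p + 1) → ℕ) → ℂ → ℂ → ℂ := Sum.elim
    (fun l z₀ z₁ => (((l.2 : ℂ) + 1) * ν) * scaledDeriv ν a l.1 z₀ z₁)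
    (fun c => scaledDeriv ν (ap c.1) (c.2 0)) with hg
  -- In the second sum the exponent of `u_h` is the number of occurrences of `h` among `j_1, …,
  -- j_p`.
  set e : (ℕ × ℕ) ⊕ (Σ p : ℕ, Fin (p + 1) → ℕ) → ℕ → ℕ := Sum.elim
    (fun l h => if h = l.2 + 1 then 1 else 0)
    (fun c h => (Finset.univ.filter fun t : Fin c.1 => c.2 t.succ = h).card) with he
  set K : (ℕ × ℕ) ⊕ (Σ p : ℕ, Fin (p + 1) → ℕ) → ℝ := Sum.elim
    (fun l => ((l.2 : ℝ) + 1) * ν * M) (fun _ => M) with hK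
  have hcmem : ∀ p (c : Fin (p + 1) → ℕ), c ∈ Finset.Nat.antidiagonalTuple (p + 1) j →
      ∀ t ∈ (Finset.univ : Finset (Fin p)), c t.succ ∈ Finset.range (N + 1) := by
    intro p c hc t _
    have h1 : c t.succ ≤ ∑ t, c t :=
      Finset.single_le_sum (fun _ _ => Nat.zero_le _) (Finset.mem_univ t.succ)
    rw [Finset.Nat.mem_antidiagonalTuple.1 hc] at h1
    exact Finset.mem_range.2 (by omega)
  have hF : IsSumOfProducts R s (Finset.range (N + 1)) g (fun i h => X ^ e i h)
      (funA ν d a ap j) := by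
    intro x _
    rw [funA, hs, Finset.sum_disjSum, Finset.sum_sigma]
    simp only [hg, he, Sum.elim_inl, Sum.elim_inr, eval_pow, eval_X]
    congr 1
    · refine Finset.sum_congr rfl fun l hl => ?_
      have : l.2 + 1 ∈ Finset.range (N + 1) := by
        rw [mem_antidiagonal] at hl
        exact Finset.mem_range.2 (by omega)
      simp only [pow_ite, pow_one, pow_zero]
      rw [Finset.prod_ite_eq' _ _ (fun h => x (U h)), if_pos this]
      ring
    · refine Finset.sum_congr rfl fun p _ => Finset.sum_congr rfl fun c hc => ?_
      congr 1
      rw [← Finset.prod_fiberwise_of_maps_to' (hcmem p c hc) fun h => x (U h)]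
      exact Finset.prod_congr rfl fun h _ => Finset.prod_const _
  have hcoef : ∀ i ∈ s, CoefBound R r₀ r₁ (K i) (g i) := by
    rintro (l | c) hi
    · have h1 := (ha l.1).const_mul (((l.2 : ℂ) + 1) * ν)
      have h2 : ‖((l.2 : ℂ) + 1) * (ν : ℂ)‖ = ((l.2 : ℝ) + 1) * ν := by
        rw [norm_mul, Complex.norm_real, Real.norm_of_nonneg hν.le, ← Nat.cast_add_one,
          Complex.norm_natCast]
        push_cast
        rfl
      rwa [h2] at h1
    · have : c.1 ≤ d := by
        have := (Finset.mem_sigma.1 (Finset.inr_mem_disjSum.1 hi)).1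
        exact Nat.lt_succ_iff.1 (Finset.mem_range.1 this)
      exact hap c.1 this _
  have hK0 : ∀ i ∈ s, 0 ≤ K i := by
    rintro (l | c) _
    · simp only [hK, Sum.elim_inl]; positivity
    · exact hM
  have hdeg : ∀ i ∈ s, ∑ h ∈ Finset.range (N + 1), e i h ≤ max 1 d := by
    rintro (l | c) hi
    · simp only [he, Sum.elim_inl, Finset.sum_ite_eq']
      split_ifs <;> simp
    · have hc := Finset.mem_sigma.1 (Finset.inr_mem_disjSum.1 hi)
      have h1 := Finset.card_eq_sum_card_fiberwise (hcmem c.1 c.2 hc.2)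
      simp only [Finset.card_univ, Fintype.card_fin] at h1
      have h2 := Finset.mem_range.1 hc.1
      simp only [he, Sum.elim_inr]
      rw [← h1]
      exact le_max_of_le_right (by omega)
  have hj1 : (1 : ℝ) ≤ (j : ℝ) + 1 := by linarith [(Nat.cast_nonneg j : (0 : ℝ) ≤ j)]
  have hsum : ∑ i ∈ s, K i ≤ M * (ν + (d + 1)) * ((j : ℝ) + 1) ^ max 2 d := by
    rw [hs, Finset.sum_disjSum, Finset.sum_sigma]
    simp only [hK, Sum.elim_inl, Sum.elim_inr, Finset.sum_const, nsmul_eq_mul]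
    have h1 : ∑ l ∈ antidiagonal j, ((l.2 : ℝ) + 1) * ν * M ≤
        ν * M * ((j : ℝ) + 1) ^ max 2 d := by
      calc _ ≤ ∑ l ∈ antidiagonal j, ((j : ℝ) + 1) * ν * M := by
            refine Finset.sum_le_sum fun l hl => ?_
            rw [mem_antidiagonal] at hl
            have : (l.2 : ℝ) ≤ j := by exact_mod_cast (by omega : l.2 ≤ j)
            gcongr
        _ = ν * M * ((j : ℝ) + 1) ^ 2 := by
            rw [Finset.sum_const, Finset.Nat.card_antidiagonal, nsmul_eq_mul]
            push_cast
            ring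
        _ ≤ _ := mul_le_mul_of_nonneg_left (pow_le_pow_right₀ hj1 (le_max_left _ _))
            (by positivity)
    have h2 : ∑ p ∈ Finset.range (d + 1),
        ((Finset.Nat.antidiagonalTuple (p + 1) j).card : ℝ) * M ≤
        (d + 1) * M * ((j : ℝ) + 1) ^ max 2 d := by
      calc _ ≤ ∑ p ∈ Finset.range (d + 1), ((j : ℝ) + 1) ^ max 2 d * M := by
            refine Finset.sum_le_sum fun p hp => ?_
            have h3 : ((Finset.Nat.antidiagonalTuple (p + 1) j).card : ℝ) ≤ ((j : ℝ) + 1) ^ p := by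
              exact_mod_cast card_antidiagonalTuple_le p j
            have h4 : p ≤ max 2 d :=
              le_max_of_le_right (Nat.lt_succ_iff.1 (Finset.mem_range.1 hp))
            exact mul_le_mul_of_nonneg_right (h3.trans (pow_le_pow_right₀ hj1 h4)) hM
        _ = _ := by
            rw [Finset.sum_const, Finset.card_range, nsmul_eq_mul]
            push_cast
            ring
    calc _ ≤ ν * M * ((j : ℝ) + 1) ^ max 2 d + (d + 1) * M * ((j : ℝ) + 1) ^ max 2 d :=
          add_le_add h1 h2
      _ = _ := by ring
  refine (hF.l1Norm_majorant_le hcoef hK0 hw hw₀ hw₁ hwU hρ hdeg).trans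
    (ENNReal.ofReal_le_ofReal ?_)
  have hi₀ : 0 ≤ (1 - w (V 0) / r₀)⁻¹ := inv_nonneg.2 (by linarith [(div_lt_one hr₀).2 hw₀])
  have hi₁ : 0 ≤ (1 - w (V 1) / r₁)⁻¹ := inv_nonneg.2 (by linarith [(div_lt_one hr₁).2 hw₁])
  calc _ ≤ (1 - w (V 0) / r₀)⁻¹ * (1 - w (V 1) / r₁)⁻¹ *
        (M * (ν + (d + 1)) * ((j : ℝ) + 1) ^ max 2 d * ((1 + δ) * ρ) ^ max 1 d) := by
        gcongr
    _ = _ := by rw [mul_pow]; ring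

theorem coefBound_const {R r r₁ : ℝ} (h₁ : 0 < r₁) (hr : r₁ < r) (z : ℂ) :
    CoefBound R r r₁ ‖z‖ fun _ _ => z := by
  have h : SepHolBounded (R + r + 1) ‖z‖ fun _ _ => z :=
    ⟨fun _ _ => differentiableOn_const _, fun _ _ => differentiableOn_const _,
      fun _ _ _ _ => le_rfl⟩
  simpa using h.coefBound (norm_nonneg z) (h₁.trans hr) (lt_add_one _) h₁ (sub_pos.2 hr)
    (by linarith) 0

theorem l1Norm_majorant_funB_le {R r₀ r₁ ν ρ δ : ℝ} {j N : ℕ} {w : Var → ℝ} (hν : 0 < ν)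
    (hr : r₁ < r₀) (hw : ∀ i, 0 < w i) (hw₀ : w (V 0) < r₀) (hw₁ : w (V 1) < r₁)
    (hwU : ∀ h, w (U h) ≤ δ) (hρ : 1 ≤ ρ) (hj : j + 1 ≤ N) :
    l1Norm w (majorant R ρ N (funB ν j)) ≤
      ENNReal.ofReal ((1 - w (V 0) / r₀)⁻¹ * (1 - w (V 1) / r₁)⁻¹ * (ν * (1 + δ)) *
        ((j : ℝ) + 1) ^ 1 * ρ ^ 1) := by
  have hnorm : ‖((j : ℂ) + 1) * (ν : ℂ)‖ = ((j : ℝ) + 1) * ν := by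
    rw [norm_mul, Complex.norm_real, Real.norm_of_nonneg hν.le, ← Nat.cast_add_one,
      Complex.norm_natCast]
    push_cast
    rfl
  have hF : IsSumOfProducts R (Finset.univ : Finset Unit) (Finset.range (N + 1))
      (fun _ _ _ => ((j : ℂ) + 1) * ν) (fun _ h => X ^ (if h = j + 1 then 1 else 0))
      (funB ν j) := by
    intro x _
    have : j + 1 ∈ Finset.range (N + 1) := Finset.mem_range.2 (by omega)
    simp only [funB, eval_pow, eval_X, Finset.univ_unique, Finset.sum_singleton]
    simp only [pow_ite, pow_one, pow_zero]
    rw [Finset.prod_ite_eq' _ _ (fun h => x (U h)), if_pos this]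
  refine (hF.l1Norm_majorant_le (K := fun _ => ((j : ℝ) + 1) * ν) (D := 1) (fun _ _ => ?_)
    (fun _ _ => by positivity) hw hw₀ hw₁ hwU hρ fun _ _ => ?_).trans
    (ENNReal.ofReal_le_ofReal (le_of_eq ?_))
  · rw [← hnorm]
    exact coefBound_const ((hw _).trans hw₁) hr _
  · rw [Finset.sum_ite_eq']
    split_ifs <;> simp
  · simp
    ring

/-! ### The coefficients `b_α` -/

/-- Lagrange interpolation at `0, …, n` expresses the coefficients of `P` through finitely many
values. This transfers holomorphy and bounds from `β` at fixed integers `u₀` to its coefficients in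
`u₀`. -/
theorem eval_eq_sum_basis_coeff {n : ℕ} {P : ℂ[X]} (hP : P.natDegree ≤ n) (u : ℂ) :
    P.eval u = ∑ c ∈ Finset.range (n + 1) ×ˢ Finset.range (n + 1),
      (Lagrange.basis (Finset.range (n + 1)) (fun i : ℕ => (i : ℂ)) c.1).coeff c.2 *
        P.eval (c.1 : ℂ) * u ^ c.2 := by
  have hinj : Set.InjOn (fun i : ℕ => (i : ℂ)) (Finset.range (n + 1)) :=
    fun _ _ _ _ h => Nat.cast_injective h
  have hdeg : P.degree < (Finset.range (n + 1)).card := by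
    rw [Finset.card_range]
    exact (degree_le_natDegree).trans_lt (by exact_mod_cast Nat.lt_succ_of_le hP)
  rw [Finset.sum_product]
  conv_lhs => rw [Lagrange.eq_interpolate hinj hdeg, Lagrange.interpolate_apply, eval_finsetSum]
  refine Finset.sum_congr rfl fun i hi => ?_
  have hb : (Lagrange.basis (Finset.range (n + 1)) (fun i : ℕ => (i : ℂ)) i).natDegree < n + 1 := by
    refine Nat.lt_succ_of_le (natDegree_le_of_degree_le ?_)
    rw [Lagrange.degree_basis hinj hi, Finset.card_range]
    simp
  rw [eval_mul, eval_C, eval_eq_sum_range' hb, Finset.mul_sum]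
  exact Finset.sum_congr rfl fun l _ => by ring

section coefficient

variable {R' wbar : ℝ} {n : ℕ} {β : ℂ × ℂ × ℂ × ℂ → ℂ}

theorem IsCoefficient.differentiableOn_slice (h : IsCoefficient R' wbar n β) {z₀ z₁ : ℂ} (u : ℂ)
    (hz₀ : z₀ ∈ ball (0 : ℂ) R') (hz₁ : z₁ ∈ ball (0 : ℂ) R') :
    DifferentiableOn ℂ (fun ω => β (z₀, z₁, u, ω)) (ball 0 wbar) :=
  h.holomorphic.comp (f := fun ω => (z₀, z₁, u, ω)) (by fun_prop)
    fun _ hω => ⟨hz₀, hz₁, Set.mem_univ _, hω⟩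

theorem IsCoefficient.exists_sepHolBounded (h : IsCoefficient R' wbar n β) {ϱ w₁ : ℝ}
    (hϱ : ϱ < R') (hw₁ : 0 < w₁) (hw₁' : w₁ < wbar) (u : ℂ) :
    ∃ M, 0 ≤ M ∧ ∀ α, SepHolBounded ϱ (M * (α ! / w₁ ^ α))
      fun z₀ z₁ => iteratedDeriv α (fun ω => β (z₀, z₁, u, ω)) 0 := by
  have hsub : ball (0 : ℂ) ϱ ⊆ ball 0 R' := ball_subset_ball hϱ.le
  have hsubw : closedBall (0 : ℂ) w₁ ⊆ ball 0 wbar := closedBall_subset_ball hw₁'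
  have hK : IsCompact (closedBall (0 : ℂ) ϱ ×ˢ closedBall (0 : ℂ) ϱ ×ˢ ({u} : Set ℂ) ×ˢ
      closedBall (0 : ℂ) w₁) :=
    (isCompact_closedBall _ _).prod ((isCompact_closedBall _ _).prod
      (isCompact_singleton.prod (isCompact_closedBall _ _)))
  obtain ⟨M, hM⟩ := hK.exists_bound_of_continuousOn (h.holomorphic.continuousOn.mono
    (Set.prod_mono (closedBall_subset_ball hϱ) (Set.prod_mono (closedBall_subset_ball hϱ)
      (Set.prod_mono (Set.subset_univ _) hsubw))))
  have hM' : ∀ z₀ ∈ ball (0 : ℂ) ϱ, ∀ z₁ ∈ ball (0 : ℂ) ϱ, ∀ ω ∈ closedBall (0 : ℂ) w₁,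
      ‖β (z₀, z₁, u, ω)‖ ≤ max M 0 := fun z₀ hz₀ z₁ hz₁ ω hω =>
    (hM (z₀, z₁, u, ω) ⟨ball_subset_closedBall hz₀, ball_subset_closedBall hz₁, rfl, hω⟩).trans
      (le_max_left _ _)
  have hball : ball (0 : ℂ) w₁ ⊆ ball 0 wbar := ball_subset_ball hw₁'.le
  refine ⟨max M 0, le_max_right _ _, fun α => ⟨fun z₁ hz₁ => ?_, fun z₀ hz₀ => ?_,
    fun z₀ hz₀ z₁ hz₁ => ?_⟩⟩
  · refine differentiableOn_iteratedDeriv_param α isOpen_ball hw₁ (fun ω hω => ?_)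
      (fun s hs => (h.differentiableOn_slice u (hsub hs) (hsub hz₁)).mono hball)
      fun s hs ω hω => hM' s hs z₁ hz₁ ω (ball_subset_closedBall hω)
    exact h.holomorphic.comp (f := fun s => (s, z₁, u, ω)) (by fun_prop)
      fun s hs => ⟨hsub hs, hsub hz₁, Set.mem_univ _, hball hω⟩
  · refine differentiableOn_iteratedDeriv_param α isOpen_ball hw₁ (fun ω hω => ?_)
      (fun s hs => (h.differentiableOn_slice u (hsub hz₀) (hsub hs)).mono hball)
      fun s hs ω hω => hM' z₀ hz₀ s hs ω (ball_subset_closedBall hω)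
    exact h.holomorphic.comp (f := fun s => (z₀, s, u, ω)) (by fun_prop)
      fun s hs => ⟨hsub hz₀, hsub hs, Set.mem_univ _, hball hω⟩
  · refine (Complex.norm_iteratedDeriv_le_of_forall_mem_sphere_norm_le α hw₁
      (((h.differentiableOn_slice u (hsub hz₀) (hsub hz₁)).mono hsubw).diffContOnCl_ball subset_rfl)
      fun ω hω => hM' z₀ hz₀ z₁ hz₁ ω (sphere_subset_closedBall hω)).trans (le_of_eq (by ring))

theorem IsCoefficient.wCoeff_eq (h : IsCoefficient R' wbar n β) (hwbar : 0 < wbar) (α : ℕ)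
    {x : Var → ℂ} (hx : x ∈ vBidisc R') :
    wCoeff β α x = ∑ c ∈ Finset.range (n + 1) ×ˢ Finset.range (n + 1),
      (Lagrange.basis (Finset.range (n + 1)) (fun i : ℕ => (i : ℂ)) c.1).coeff c.2 *
        iteratedDeriv α (fun ω => β (x (V 0), x (V 1), (c.1 : ℂ), ω)) 0 * x (U 0) ^ c.2 := by
  have h0 := mem_ball_zero_iff.2 (hx 0)
  have h1 := mem_ball_zero_iff.2 (hx 1)
  have hnhds := isOpen_ball.mem_nhds (mem_ball_self (x := (0 : ℂ)) hwbar)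
  have hev : (fun ω : ℂ => β (x (V 0), x (V 1), x (U 0), ω)) =ᶠ[nhds 0] fun ω =>
      ∑ c ∈ Finset.range (n + 1) ×ˢ Finset.range (n + 1),
        (Lagrange.basis (Finset.range (n + 1)) (fun i : ℕ => (i : ℂ)) c.1).coeff c.2 *
          β (x (V 0), x (V 1), (c.1 : ℂ), ω) * x (U 0) ^ c.2 := by
    filter_upwards [hnhds] with ω hω
    obtain ⟨P, hP, hPβ⟩ := h.polynomial _ h0 _ h1 ω hω
    simp_rw [hPβ]
    exact eval_eq_sum_basis_coeff hP _
  rw [wCoeff, hev.iteratedDeriv_eq, iteratedDeriv_fun_sum]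
  · refine Finset.sum_congr rfl fun c _ => ?_
    rw [iteratedDeriv_mul_const_field, iteratedDeriv_const_mul_field]
  · intro c _
    exact (contDiffAt_const.mul (((h.differentiableOn_slice (c.1 : ℂ) h0 h1).contDiffOn
      isOpen_ball).contDiffAt hnhds)).mul contDiffAt_const

/-- Interpolation writes `b_α` as a finite sum of functions of `(v₀, v₁)` times `u₀^l`, `l ≤ n`.
Cauchy's estimate in `w` on the circle of radius `w₁` gives `α! / w₁^α`, and the degree gives `ρ^n`.
-/
theorem IsCoefficient.exists_l1Norm_majorant_le (h : IsCoefficient R' wbar n β) {R r r₁ δ w₁ : ℝ}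
    (hRr : R + r < R') (hr : 0 < r) (hr₁ : 0 < r₁) (hr₁r : r₁ < r) (hw₁ : 0 < w₁)
    (hw₁' : w₁ < wbar) {w : Var → ℝ} (hw : ∀ i, 0 < w i) (hw_V0 : w (V 0) < r)
    (hw_V1 : w (V 1) < r₁) (hwU : ∀ h, w (U h) ≤ δ) :
    ∃ C, 0 ≤ C ∧ ∀ ρ : ℝ, 1 ≤ ρ → ∀ α, l1Norm w (majorant R ρ 0 (wCoeff β α)) ≤
      ENNReal.ofReal (C * ρ ^ n * α ! * w₁⁻¹ ^ α) := by
  obtain ⟨ϱ, hϱ, hϱ'⟩ := exists_between hRr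
  have hδ : 0 < δ := (hw (U 0)).trans_le (hwU 0)
  choose M hM hsep using fun i : ℕ => h.exists_sepHolBounded hϱ' hw₁ hw₁' (i : ℂ)
  set s := Finset.range (n + 1) ×ˢ Finset.range (n + 1) with hs
  set L : ℕ × ℕ → ℂ := fun c =>
    (Lagrange.basis (Finset.range (n + 1)) (fun i : ℕ => (i : ℂ)) c.1).coeff c.2 with hL
  have hi₀ : 0 ≤ (1 - w (V 0) / r)⁻¹ := inv_nonneg.2 (by linarith [(div_lt_one hr).2 hw_V0])
  have hi₁ : 0 ≤ (1 - w (V 1) / r₁)⁻¹ := inv_nonneg.2 (by linarith [(div_lt_one hr₁).2 hw_V1])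
  have hS : 0 ≤ ∑ c ∈ s, ‖L c‖ * M c.1 :=
    Finset.sum_nonneg fun c _ => mul_nonneg (norm_nonneg _) (hM _)
  refine ⟨(1 - w (V 0) / r)⁻¹ * (1 - w (V 1) / r₁)⁻¹ * ((∑ c ∈ s, ‖L c‖ * M c.1) * (1 + δ) ^ n),
    by positivity, fun ρ hρ α => ?_⟩
  have hF : IsSumOfProducts R s (Finset.range (0 + 1))
      (fun c z₀ z₁ => L c * iteratedDeriv α (fun ω => β (z₀, z₁, (c.1 : ℂ), ω)) 0)
      (fun c _ => X ^ c.2) (wCoeff β α) := by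
    intro x hx
    rw [h.wCoeff_eq (hw₁.trans hw₁') α fun i => (hx i).trans (by linarith)]
    simp [hL, hs]
  refine (hF.l1Norm_majorant_le (r₀ := r) (r₁ := r₁) (e := fun c _ => c.2)
    (K := fun c => ‖L c‖ * (M c.1 * (α ! / w₁ ^ α))) (D := n) (fun c _ => ?_)
    (fun c _ => ?_) hw hw_V0 hw_V1 hwU hρ fun c hc => ?_).trans
    (ENNReal.ofReal_le_ofReal (le_of_eq ?_))
  -- No prior derivative in `v₁` is taken, so `l = 0` and the radius loss `r - r₁` costs nothing.
  · have h1 := (hsep c.1 α).coefBound (mul_nonneg (hM _) (by positivity)) hr hϱ hr₁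
      (sub_pos.2 hr₁r) (by linarith) 0
    simp only [iteratedDeriv_zero, Nat.factorial_zero, Nat.cast_one, pow_zero, div_one,
      mul_one] at h1
    exact h1.const_mul (L c)
  · exact mul_nonneg (norm_nonneg _) (mul_nonneg (hM _) (by positivity))
  · have := Finset.mem_range.1 (Finset.mem_product.1 hc).2
    simp only [zero_add, Finset.range_one, Finset.sum_singleton]
    omega
  · simp_rw [← mul_assoc]
    rw [← Finset.sum_mul, mul_pow, inv_pow]
    ring

end coefficient

/-! ### The estimate for `B ∂_W^{-s} 𝔻` -/

/-- The exponent `1 + b + E` collects the `γ + 1` terms, the bound `(j^b + 1) / δ ≤ (2 / δ)(γ +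
2)^b` for `1 / Ū_j`, and the growth of the majorants in `j`. -/
theorem sum_l1Norm_mul_inv_radius_le {b δ ρ c : ℝ} (hb : 0 ≤ b) (hδ : 0 < δ) (hρ : 0 ≤ ρ)
    (hc : 0 ≤ c) {w : Var → ℝ} (hw : ∀ h, w (U h) = δ / ((h : ℝ) ^ b + 1)) {Φ : ℕ → VUSeries}
    {γ E D : ℕ} (h : ∀ j ≤ γ, l1Norm w (Φ j) ≤ ENNReal.ofReal (c * ((j : ℝ) + 1) ^ E * ρ ^ D)) :
    ∑ j ∈ Finset.range (γ + 1), l1Norm w (Φ j) * ENNReal.ofReal (w (U j))⁻¹ ≤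
      ENNReal.ofReal (c * (2 / δ) * ρ ^ D * ((γ : ℝ) + 2) ^ (1 + b + E)) := by
  have hγ0 : (0 : ℝ) ≤ γ := Nat.cast_nonneg γ
  set Γ : ℝ := (γ : ℝ) + 2 with hΓ
  have hΓ1 : 1 ≤ Γ := by linarith
  have hΓ0 : 0 < Γ := by linarith
  have hterm : ∀ j ∈ Finset.range (γ + 1), l1Norm w (Φ j) * ENNReal.ofReal (w (U j))⁻¹ ≤
      ENNReal.ofReal (c * Γ ^ E * ρ ^ D * (2 / δ * Γ ^ b)) := by
    intro j hj
    have hjγ : j ≤ γ := Nat.lt_succ_iff.1 (Finset.mem_range.1 hj)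
    have hj' : (j : ℝ) ≤ γ := by exact_mod_cast hjγ
    have hj0 : (0 : ℝ) ≤ j := Nat.cast_nonneg j
    rw [ENNReal.ofReal_mul (by positivity : 0 ≤ c * Γ ^ E * ρ ^ D)]
    refine mul_le_mul' ((h j hjγ).trans (ENNReal.ofReal_le_ofReal ?_))
      (ENNReal.ofReal_le_ofReal ?_)
    · gcongr
      linarith
    · have h1 : (j : ℝ) ^ b ≤ Γ ^ b := Real.rpow_le_rpow hj0 (by linarith) hb
      have h2 : 1 ≤ Γ ^ b := Real.one_le_rpow hΓ1 hb
      rw [hw, inv_div, div_mul_eq_mul_div]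
      gcongr
      linarith
  refine (Finset.sum_le_sum hterm).trans ?_
  rw [Finset.sum_const, Finset.card_range, nsmul_eq_mul, ← ENNReal.ofReal_natCast,
    ← ENNReal.ofReal_mul (Nat.cast_nonneg _)]
  refine ENNReal.ofReal_le_ofReal ?_
  have h1 : ((γ + 1 : ℕ) : ℝ) ≤ Γ := by push_cast; linarith
  calc _ ≤ Γ * (c * Γ ^ E * ρ ^ D * (2 / δ * Γ ^ b)) := by gcongr
    _ = _ := by
      rw [Real.rpow_add hΓ0, Real.rpow_add hΓ0, Real.rpow_one, Real.rpow_natCast]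
      ring

theorem pow_mul_exp_neg_le {x : ℝ} (hx : 0 ≤ x) (n : ℕ) : x ^ n * Real.exp (-x) ≤ n ! := by
  have h := Real.pow_div_factorial_le_exp x hx n
  rw [div_le_iff₀ (by positivity)] at h
  rw [Real.exp_neg, ← div_eq_mul_inv, div_le_iff₀ (Real.exp_pos x)]
  linarith

theorem factorial_div_factorial_le (γ u : ℕ) :
    ((γ + 1)! : ℝ) / (γ + 1 + u)! ≤ 1 / ((γ : ℝ) + 2) ^ u := by
  rw [div_le_div_iff₀ (by positivity) (by positivity), one_mul]
  have := Nat.factorial_mul_pow_le_factorial (m := γ + 1) (n := u)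
  have h2 : ((γ + 1)! : ℝ) * (((γ + 1 : ℕ) : ℝ) + 1) ^ u ≤ (γ + 1 + u)! := by exact_mod_cast this
  have h3 : ((γ + 1 : ℕ) : ℝ) + 1 = γ + 2 := by push_cast; ring
  rwa [h3] at h2

/-- With `Γ = γ + 2`, the exponential turns `ρ^n` into `n! / σ^n · Γ^{bn}`, and the factorial
quotient is at most `Γ^{-(s-1)}`. The hypothesis `hx` makes the total exponent of `Γ` nonpositive.
-/
theorem gain_le_const {b σ ρ c : ℝ} (hσ : 0 < σ) (hρ : 0 < ρ) (hc : 0 ≤ c) {x : ℝ} {n s : ℕ}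
    (hs : 1 ≤ s) (hx : x + b * n ≤ s - 1) (γ : ℕ) :
    c * ρ ^ n * ((γ : ℝ) + 2) ^ x * (((γ + 1)! : ℝ) / (γ + s)!) *
      Real.exp (-(σ * (1 / ((γ : ℝ) + 2) ^ b) * ρ)) ≤ c * (n ! / σ ^ n) := by
  obtain ⟨u, rfl⟩ : ∃ u, s = 1 + u := ⟨s - 1, by omega⟩
  have hγ0 : (0 : ℝ) ≤ γ := Nat.cast_nonneg γ
  set Γ : ℝ := (γ : ℝ) + 2 with hΓ
  have hΓ1 : 1 ≤ Γ := by linarith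
  have hΓ0 : 0 < Γ := by linarith
  have hb0 : 0 < Γ ^ b := Real.rpow_pos_of_pos hΓ0 b
  have h1 := factorial_div_factorial_le γ u
  rw [add_assoc γ 1 u] at h1
  have h2 := pow_mul_exp_neg_le (x := σ * (1 / Γ ^ b) * ρ) (by positivity) n
  have h3 : ρ ^ n * Real.exp (-(σ * (1 / Γ ^ b) * ρ)) ≤ n ! / σ ^ n * (Γ ^ b) ^ n := by
    have h4 : ρ ^ n = (σ * (1 / Γ ^ b) * ρ) ^ n * ((Γ ^ b) ^ n / σ ^ n) := by
      rw [← div_pow, ← mul_pow]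
      congr 1
      field_simp
    rw [h4]
    calc _ = (σ * (1 / Γ ^ b) * ρ) ^ n * Real.exp (-(σ * (1 / Γ ^ b) * ρ)) *
          ((Γ ^ b) ^ n / σ ^ n) := by ring
      _ ≤ n ! * ((Γ ^ b) ^ n / σ ^ n) := by gcongr
      _ = _ := by ring
  have h5 : Γ ^ x * (Γ ^ b) ^ n * (1 / Γ ^ u) ≤ 1 := by
    rw [← Real.rpow_natCast (Γ ^ b) n, ← Real.rpow_mul hΓ0.le, ← Real.rpow_add hΓ0, mul_one_div,
      ← Real.rpow_natCast Γ u, div_le_one (Real.rpow_pos_of_pos hΓ0 _)]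
    refine Real.rpow_le_rpow_of_exponent_le hΓ1 ?_
    push_cast at hx
    linarith
  have hx0 : 0 < Γ ^ x := Real.rpow_pos_of_pos hΓ0 x
  calc _ = c * (Γ ^ x * (ρ ^ n * Real.exp (-(σ * (1 / Γ ^ b) * ρ))) *
        (((γ + 1)! : ℝ) / (γ + (1 + u))!)) := by ring
    _ ≤ c * (Γ ^ x * (n ! / σ ^ n * (Γ ^ b) ^ n) * (1 / Γ ^ u)) := by gcongr
    _ = c * (n ! / σ ^ n) * (Γ ^ x * (Γ ^ b) ^ n * (1 / Γ ^ u)) := by ring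
    _ ≤ c * (n ! / σ ^ n) * 1 := by gcongr
    _ = _ := mul_one _

theorem radius_U_le {b Vbar₀ Vbar₁ δ : ℝ} (hδ : 0 < δ) (h : ℕ) :
    radius b Vbar₀ Vbar₁ δ (U h) ≤ δ := by
  have : (0 : ℝ) ≤ (h : ℝ) ^ b := by positivity
  exact div_le_self hδ.le (by linarith)

theorem exists_memG_and_normG_le {R R' r r₁ wbar b σ Vbar₀ Vbar₁ δ c W₀ : ℝ} {n E D s : ℕ}
    {β : ℂ × ℂ × ℂ × ℂ → ℂ} {F : ℕ → (Var → ℂ) → ℂ} (hβ : IsCoefficient R' wbar n β)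
    (hb : 1 < b) (hσ : 0 < σ) (hδ : 0 < δ) (hV₀ : 0 < Vbar₀) (hV₁ : 0 < Vbar₁) (hW₀ : 0 < W₀)
    (hW₀' : W₀ < wbar) (hRr : R + r < R') (hr₁ : Vbar₁ < r₁) (hr₁r : r₁ < r) (hr : Vbar₀ < r)
    (hs : 1 ≤ s) (hc : 0 ≤ c)
    (hF : ∀ ρ : ℝ, 1 < ρ → ∀ γ j : ℕ, j ≤ γ →
      l1Norm (radius b Vbar₀ Vbar₁ δ) (majorant R ρ (γ + 1) (F j)) ≤
        ENNReal.ofReal (c * ((j : ℝ) + 1) ^ E * ρ ^ D))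
    (hES : 1 + b + E + b * (n + D) ≤ s - 1) :
    ∃ C : ℝ, 0 < C ∧ ∀ ρ : ℝ, 1 < ρ → ∀ Wbar : ℝ, 0 < Wbar → Wbar ≤ W₀ →
      ∀ Ψ : WSeries, MemG b σ Vbar₀ Vbar₁ δ ρ Wbar Ψ →
        MemG b σ Vbar₀ Vbar₁ δ ρ Wbar (seriesB R ρ β * intW^[s] (opD R ρ F Ψ)) ∧
        normG b σ Vbar₀ Vbar₁ δ ρ Wbar (seriesB R ρ β * intW^[s] (opD R ρ F Ψ))
          ≤ C * Wbar ^ s * normG b σ Vbar₀ Vbar₁ δ ρ Wbar Ψ := by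
  -- The Cauchy radius in `w`: below `wbar` for the bounds on `b_α`, above `W₀` so that the
  -- geometric ratio `Wbar / w₁` stays at most `W₀ / w₁ < 1` for all admissible `Wbar`.
  obtain ⟨w₁, hw₁, hw₁'⟩ := exists_between hW₀'
  have hw₁0 : 0 < w₁ := hW₀.trans hw₁
  have hw : ∀ i, 0 < radius b Vbar₀ Vbar₁ δ i := radius_pos hV₀ hV₁ hδ
  have hwV0 : radius b Vbar₀ Vbar₁ δ (V 0) = Vbar₀ := rfl
  have hwV1 : radius b Vbar₀ Vbar₁ δ (V 1) = Vbar₁ := rfl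
  obtain ⟨CB, hCB, hB⟩ := hβ.exists_l1Norm_majorant_le hRr (hV₀.trans hr) (hV₁.trans hr₁) hr₁r hw₁0
    hw₁' hw (hwV0.trans_lt hr) (hwV1.trans_lt hr₁) (radius_U_le hδ)
  set K := CB * c * (2 / δ) * ((n + D)! / σ ^ (n + D)) with hK
  have hK0 : 0 ≤ K := by positivity
  have hq : w₁⁻¹ * W₀ < 1 := by rwa [inv_mul_lt_one₀ hw₁0]
  -- The summand `1` only makes the constant strictly positive.
  refine ⟨K * (1 - w₁⁻¹ * W₀)⁻¹ + 1, by
    have : 0 ≤ (1 - w₁⁻¹ * W₀)⁻¹ := inv_nonneg.2 (by linarith)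
    positivity, fun ρ hρ Wbar hW hWW₀ Ψ hΨ => ?_⟩
  have hρ0 : 0 < ρ := by linarith
  have hqW : w₁⁻¹ * Wbar ≤ w₁⁻¹ * W₀ := by gcongr
  have hinv : (1 - w₁⁻¹ * Wbar)⁻¹ ≤ (1 - w₁⁻¹ * W₀)⁻¹ :=
    inv_anti₀ (by linarith) (by linarith)
  have hinv0 : 0 ≤ (1 - w₁⁻¹ * W₀)⁻¹ := inv_nonneg.2 (by linarith)
  refine memG_and_normG_le hw hW (by positivity) hΨ
    (supported_component (fun α => (hΨ.memE α).supported) hs) ?_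
  refine (totalNorm_mul_intW_opD_le (q := w₁⁻¹) (KB := CB * ρ ^ n) (K := K)
    (f := fun γ => c * (2 / δ) * ρ ^ D * ((γ : ℝ) + 2) ^ (1 + b + E)) hw hσ hρ0 hW
    (by positivity) (by linarith) (by positivity) hK0 hs (fun γ => by positivity) (hB ρ hρ.le)
    (fun γ => sum_l1Norm_mul_inv_radius_le (by linarith) hδ hρ0.le hc (fun _ => rfl) (hF ρ hρ γ))
    (fun γ => ?_) Ψ).trans (mul_le_mul_left (ENNReal.ofReal_le_ofReal ?_) _)
  -- The powers `ρ^n` from `B` and `ρ^D` from `𝔻` are absorbed together.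
  · have := gain_le_const (b := b) hσ hρ0 (by positivity : 0 ≤ CB * c * (2 / δ)) (n := n + D) hs
      (by push_cast; exact hES) γ
    refine le_trans (le_of_eq ?_) this
    ring
  · gcongr
    nlinarith

end MajorantSeries

/-! ### Choice of the radii and count of the exponents -/

open MajorantSeries in
theorem proposition8
    (R R' wbar : ℝ) (hR : 0 < R) (hRR' : R < R') (hwbar : 0 < wbar)
    (d : ℕ) (a : ℂ × ℂ → ℂ) (ap : ℕ → ℂ × ℂ → ℂ)
    (ha : DifferentiableOn ℂ a (Metric.ball 0 R' ×ˢ Metric.ball 0 R'))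
    (hap : ∀ p ≤ d, DifferentiableOn ℂ (ap p) (Metric.ball 0 R' ×ˢ Metric.ball 0 R'))
    (d₁ d₂ : ℕ) (β₁ β₂ : ℂ × ℂ × ℂ × ℂ → ℂ)
    (hβ₁ : IsCoefficient R' wbar d₁ β₁) (hβ₂ : IsCoefficient R' wbar d₂ β₂)
    (ν b σ Vbar₀ Vbar₁ δbar : ℝ)
    (hν : 0 < ν) (hb : 1 < b) (hσ : 0 < σ) (hδbar : 0 < δbar)
    (hVbar₀ : 0 < Vbar₀) (hVbar₀' : Vbar₀ < R' - R)
    (hVbar₁ : 0 < Vbar₁) (hVbar₁' : Vbar₁ < R' - R)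
    (S k : ℕ) :
    (1 < ν * (R' - R - Vbar₁) →
      (S : ℝ) ≥ k + 1 + max (b * (d₁ + 2) + 3) (d + 1 + b * (d + d₁ + 1)) →
      ∀ W₀ : ℝ, 0 < W₀ → W₀ < wbar →
        ∃ C : ℝ, 0 < C ∧ ∀ ρ : ℝ, 1 < ρ → ∀ Wbar : ℝ, 0 < Wbar → Wbar ≤ W₀ →
          ∀ Ψ : WSeries, MemG b σ Vbar₀ Vbar₁ δbar ρ Wbar Ψ →
            MemG b σ Vbar₀ Vbar₁ δbar ρ Wbar
              (seriesB R ρ β₁ * intW^[S - k] (opDA R ρ ν d a ap Ψ)) ∧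
            normG b σ Vbar₀ Vbar₁ δbar ρ Wbar
                (seriesB R ρ β₁ * intW^[S - k] (opDA R ρ ν d a ap Ψ))
              ≤ C * Wbar ^ (S - k) * normG b σ Vbar₀ Vbar₁ δbar ρ Wbar Ψ) ∧
    ((S : ℝ) ≥ k + 3 + b * (2 + d₂) →
      ∀ W₀ : ℝ, 0 < W₀ → W₀ < wbar →
        ∃ C : ℝ, 0 < C ∧ ∀ ρ : ℝ, 1 < ρ → ∀ Wbar : ℝ, 0 < Wbar → Wbar ≤ W₀ →
          ∀ Ψ : WSeries, MemG b σ Vbar₀ Vbar₁ δbar ρ Wbar Ψ →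
            MemG b σ Vbar₀ Vbar₁ δbar ρ Wbar
              (seriesB R ρ β₂ * intW^[S - k] (opDB R ρ ν Ψ)) ∧
            normG b σ Vbar₀ Vbar₁ δbar ρ Wbar
                (seriesB R ρ β₂ * intW^[S - k] (opDB R ρ ν Ψ))
              ≤ C * Wbar ^ (S - k) * normG b σ Vbar₀ Vbar₁ δbar ρ Wbar Ψ) := by
  have hw : ∀ i, 0 < radius b Vbar₀ Vbar₁ δbar i := radius_pos hVbar₀ hVbar₁ hδbar
  -- The hypotheses on `S` force `k ≤ S`, so the truncated subtraction is the true one.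
  have hkS : ∀ x : ℝ, 0 ≤ x → (S : ℝ) ≥ k + x → ((S - k : ℕ) : ℝ) = S - k := fun x hx h =>
    Nat.cast_sub (by exact_mod_cast (by linarith : (k : ℝ) ≤ S))
  have hs1 : ((S - k : ℕ) : ℝ) ≥ 1 → 1 ≤ S - k := fun h => by exact_mod_cast h
  have hd0 : (0 : ℝ) ≤ d := Nat.cast_nonneg d
  have hd10 : (0 : ℝ) ≤ d₁ := Nat.cast_nonneg d₁
  have hd20 : (0 : ℝ) ≤ d₂ := Nat.cast_nonneg d₂
  have hb0 : 0 < b := by linarith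
  refine ⟨fun hνR hS W₀ hW₀ hW₀' => ?_, fun hS W₀ hW₀ hW₀' => ?_⟩
  · have hmax1 := le_max_left (b * (d₁ + 2) + 3) (d + 1 + b * (d + d₁ + 1))
    have hmax2 := le_max_right (b * (d₁ + 2) + 3) (d + 1 + b * (d + d₁ + 1))
    have hp : 0 ≤ b * (d₁ + 2) := by positivity
    have hSk := hkS (1 + max (b * (d₁ + 2) + 3) (d + 1 + b * (d + d₁ + 1))) (by linarith)
      (by linarith)
    have hν' : Vbar₁ + 1 / ν < R' - R := by
      have : 1 / ν < R' - R - Vbar₁ := by rwa [div_lt_iff₀' hν]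
      linarith
    -- The largeness of `ν` leaves room for a Cauchy radius `r < R' - R` which still exceeds `Vbar₁`
    -- after the loss of `1 / ν`; the reduced radius `r - 1 / ν` serves for `v₁`.
    obtain ⟨r, hr, hrR⟩ := exists_between (max_lt hVbar₀' hν')
    have hr₀ : Vbar₀ < r := (le_max_left _ _).trans_lt hr
    have hr₁ : Vbar₁ < r - 1 / ν := by linarith [(le_max_right _ _).trans_lt hr]
    have hν1 : 0 < 1 / ν := by positivity
    obtain ⟨ϱ, hϱ, hϱ'⟩ := exists_between (show R + r < R' by linarith)
    obtain ⟨Ma, hMa, hSa⟩ := exists_sepHolBounded hϱ' ha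
    choose! Mp hMp hSp using fun p (hp : p ≤ d) => exists_sepHolBounded hϱ' (hap p hp)
    set M := Ma + ∑ p ∈ Finset.range (d + 1), Mp p with hM
    have hMp0 : ∀ p ∈ Finset.range (d + 1), 0 ≤ Mp p := fun p hp =>
      hMp p (Nat.lt_succ_iff.1 (Finset.mem_range.1 hp))
    have hM0 : 0 ≤ M := add_nonneg hMa (Finset.sum_nonneg hMp0)
    have hr0 : 0 < r := hVbar₀.trans hr₀
    have hr10 : 0 < r - 1 / ν := hVbar₁.trans hr₁
    have hca : ∀ l, CoefBound R r (r - 1 / ν) M (scaledDeriv ν a l) := fun l =>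
      (coefBound_scaledDeriv hSa hMa hr0 hϱ hr10 hν (by linarith) l).mono hr0 hr10
        (le_add_of_nonneg_right (Finset.sum_nonneg hMp0))
    have hcp : ∀ p ≤ d, ∀ l, CoefBound R r (r - 1 / ν) M (scaledDeriv ν (ap p) l) :=
      fun p hp l => (coefBound_scaledDeriv (hSp p hp) (hMp p hp) hr0 hϱ hr10 hν
        (by linarith) l).mono hr0 hr10 (le_add_of_nonneg_of_le hMa
          (Finset.single_le_sum hMp0 (Finset.mem_range.2 (Nat.lt_succ_of_le hp))))
    have hi₀ : 0 ≤ (1 - Vbar₀ / r)⁻¹ := inv_nonneg.2 (by linarith [(div_lt_one hr0).2 hr₀])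
    have hi₁ : 0 ≤ (1 - Vbar₁ / (r - 1 / ν))⁻¹ :=
      inv_nonneg.2 (by linarith [(div_lt_one hr10).2 hr₁])
    refine exists_memG_and_normG_le (n := d₁) (E := max 2 d) (D := max 1 d) hβ₁ hb hσ hδbar hVbar₀
      hVbar₁ hW₀ hW₀' (show R + r < R' by linarith) hr₁ (by linarith) hr₀
      (hs1 (by rw [hSk]; linarith)) (c := (1 - Vbar₀ / r)⁻¹ * (1 - Vbar₁ / (r - 1 / ν))⁻¹ *
        (M * (ν + (d + 1)) * (1 + δbar) ^ max 1 d)) (by positivity) (fun ρ hρ γ j hj => ?_) ?_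
    · exact l1Norm_majorant_funA_le hν hM0 hca hcp hw hr₀ hr₁ (radius_U_le hδbar) hρ.le
        (by omega)
    · rw [hSk]
      -- For `d ≤ 1` the exponents `E = 2`, `D = 1` give `3 + b(d₁ + 2)`; for `d ≥ 2`, `E = D = d`
      -- give `d + 1 + b(d + d₁ + 1)`. These are the two entries of the maximum.
      rcases Nat.lt_or_ge d 2 with hd | hd
      · rw [max_eq_left hd.le, max_eq_left (Nat.lt_succ_iff.1 hd)]
        push_cast
        linarith
      · rw [max_eq_right hd, max_eq_right (by omega)]
        linarith
  · have hp : 0 ≤ b * (2 + d₂) := by positivity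
    have hSk := hkS (3 + b * (2 + d₂)) (by linarith) (by linarith)
    obtain ⟨r, hr, hrR⟩ := exists_between (max_lt hVbar₀' hVbar₁')
    have hr₀ : Vbar₀ < r := (le_max_left _ _).trans_lt hr
    -- `B_j` contains no derivative in `v₁`, so any radius between `Vbar₁` and `r` will do and `ν`
    -- need not be large.
    obtain ⟨r₁, hr₁, hr₁r⟩ := exists_between ((le_max_right _ _).trans_lt hr)
    have hi₀ : 0 ≤ (1 - Vbar₀ / r)⁻¹ :=
      inv_nonneg.2 (by linarith [(div_lt_one (hVbar₀.trans hr₀)).2 hr₀])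
    have hi₁ : 0 ≤ (1 - Vbar₁ / r₁)⁻¹ :=
      inv_nonneg.2 (by linarith [(div_lt_one (hVbar₁.trans hr₁)).2 hr₁])
    refine exists_memG_and_normG_le (n := d₂) (E := 1) (D := 1) hβ₂ hb hσ hδbar hVbar₀
      hVbar₁ hW₀ hW₀' (show R + r < R' by linarith) hr₁ hr₁r hr₀
      (hs1 (by rw [hSk]; linarith)) (c := (1 - Vbar₀ / r)⁻¹ * (1 - Vbar₁ / r₁)⁻¹ *
        (ν * (1 + δbar))) (by positivity) (fun ρ hρ γ j hj => ?_) ?_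
    · exact l1Norm_majorant_funB_le hν hr₁r hw hr₀ hr₁ (radius_U_le hδbar) hρ.le (by omega)
    · rw [hSk]
      push_cast
      linarith
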